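/- For integers $k\ge 3$ and $r\ge 1$, let $\mathrm{SC}(k,r)$ denote the set of $kr$ points consisting of the vertices of a convex $k$-gon in the plane together with $r-1$ points subdividing each of its sides (the position of these points is immaterial), and let $\mathsf{tr}(k,r)$ be the number of its triangulations. A triangulation of a finite planar point set $S$ is a dissection of its convex hull, by non-crossing segments joining points of $S$, into triangles each of which contains no points of $S$ other than its three vertices. For $k=2$, let $\mathsf{tr}(2,r)$ be the number of triangulations of a convex $2r$-gon with vertices $p_0,\dots,p_{2r-1}$ (in cyclic order) that use no diagonal joining two vertices of the string $p_0,p_1,\dots,p_r$ or two vertices of the string $p_r,p_{r+1},\dots,p_{2r-1},p_0$. For $k=1$, where there is no geometric configuration, $\mathsf{tr}(1,r)$ denotes the value of the inclusion–exclusion expression $$\mathsf{tr}(1,r)=\sum_{m=0}^{\lfloor r/2\rfloor}(-1)^m\binom{r-m}{m}C_{r-m-2},\qquad C_n=\frac1{n+1}\binom{2n}{n}.$$ Then, for all positive integers $k$ and $r$ with $rk\ge 3$, the following integral converges absolutely and $$\mathsf{tr}(k,r)=-\frac{2^{(r-2)k}}{\pi}\int_{-\infty}^{\infty}\frac{\big((1+2iu)^{r+1}-(1-2iu)^{r+1}\big)^k}{(1+4u^2)^{rk}\,(iu)^{k-2}}\,du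 .$$ -/

import Mathlib

noncomputable section

/-- The Euclidean plane. -/
abbrev Plane : Type := EuclideanSpace ℝ (Fin 2)

/-- Twice the signed area of the triangle `p q s`; it is positive if and only if `p, q, s` make a
strict left turn. -/
def orient (p q s : Plane) : ℝ :=
  (q 0 - p 0) * (s 1 - p 1) - (q 1 - p 1) * (s 0 - p 0)

/-- `Q 0, …, Q (n-1)` are the vertices of a strictly convex polygon, in counterclockwise order. -/
def IsConvexPolygon {n : ℕ} (Q : Fin n → Plane) : Prop :=
  ∀ a b c : Fin n, a < b → b < c → 0 < orient (Q a) (Q b) (Q c)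

/-- A (maximal) triangulation of a planar point set `S`, given by the vertex sets of its triangles:
a dissection of the convex hull of `S` into non-degenerate triangles with disjoint interiors, where
the points of `S` in each (closed) triangle are exactly its three vertices. -/
structure IsTriangulation (S : Set Plane) (T : Finset (Finset Plane)) : Prop where
  card_eq : ∀ τ ∈ T, τ.card = 3
  not_collinear : ∀ τ ∈ T, ¬ Collinear ℝ (τ : Set Plane)
  inter_eq : ∀ τ ∈ T, convexHull ℝ (τ : Set Plane) ∩ S = (τ : Set Plane)
  disjoint : ∀ σ ∈ T, ∀ τ ∈ T, σ ≠ τ →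
    Disjoint (interior (convexHull ℝ (σ : Set Plane))) (interior (convexHull ℝ (τ : Set Plane)))
  cover : ⋃ τ ∈ T, convexHull ℝ (τ : Set Plane) = convexHull ℝ S

/-- A convex `k`-gon (`k ≥ 3` in all uses) each of whose sides is subdivided by `r - 1` points.
The corners are `corner i`, and the points on the side from `corner i` to `corner (i + 1)`
(cyclically), both ends included, have the affine parameters
`0 = param i 0 < param i 1 < ⋯ < param i r = 1`. -/
structure SubdividedPolygon (k r : ℕ) where
  corner : Fin k → Plane
  convex : IsConvexPolygon corner
  param : Fin k → Fin (r + 1) → ℝ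
  param_strictMono : ∀ i, StrictMono (param i)
  param_zero : ∀ i, param i 0 = 0
  param_last : ∀ i, param i (Fin.last r) = 1

/-- The set of the `k * r` points of a subdivided polygon (`finRotate k i` is `i + 1` modulo `k`). -/
def SubdividedPolygon.points {k r : ℕ} (P : SubdividedPolygon k r) : Set Plane :=
  Set.range fun ij : Fin k × Fin (r + 1) =>
    AffineMap.lineMap (P.corner ij.1) (P.corner (finRotate k ij.1)) (P.param ij.1 ij.2)

/-- The number of triangulations of a (finite) planar point set. -/
def numTriangulations (S : Set Plane) : ℕ :=
  {T : Finset (Finset Plane) | IsTriangulation S T}.ncard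

/-- The vertices of a convex `k * r`-gon are numbered `0, …, k * r - 1` cyclically, and the `i`-th
string, `0 ≤ i < k`, consists of the vertices `i * r, i * r + 1, …, i * r + r` modulo `k * r`.
The pair `a, b` is a forbidden diagonal if `a` and `b` lie on a common string and are neither equal
nor joined by a side of the polygon. -/
def IsForbiddenDiagonal (k r a b : ℕ) : Prop :=
  (∃ i < k, ∃ j ≤ r, ∃ l ≤ r, a = (i * r + j) % (k * r) ∧ b = (i * r + l) % (k * r)) ∧
    a ≠ b ∧ (a + 1) % (k * r) ≠ b ∧ (b + 1) % (k * r) ≠ a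

/-- The number of triangulations of the convex `k * r`-gon `Q` that use no forbidden diagonal, that
is, none of whose triangles has both ends of a forbidden diagonal among its vertices. -/
def numLegalTriangulations (k r : ℕ) (Q : Fin (k * r) → Plane) : ℕ :=
  {T : Finset (Finset Plane) | IsTriangulation (Set.range Q) T ∧
    ∀ τ ∈ T, ∀ a b : Fin (k * r), IsForbiddenDiagonal k r a b → ¬ (Q a ∈ τ ∧ Q b ∈ τ)}.ncard

/-- The integrand
`((1 + 2iu)^(r+1) - (1 - 2iu)^(r+1))^k / ((1 + 4u²)^(rk) (iu)^(k-2))`. The exponent `k - 2` is an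
integer (it is `-1` for `k = 1`); the value at the single point `u = 0` is immaterial. -/
def saddleIntegrand (k r : ℕ) (u : ℝ) : ℂ :=
  ((1 + 2 * Complex.I * (u : ℂ)) ^ (r + 1) - (1 - 2 * Complex.I * (u : ℂ)) ^ (r + 1)) ^ k /
    ((1 + 4 * (u : ℂ) ^ 2) ^ (r * k) * (Complex.I * (u : ℂ)) ^ ((k : ℤ) - 2))

end

noncomputable section

/-! ### Orientation and triangles -/

/-! Number the boundary points cyclically by 0, …, kr-1. Geometry enters only through the legal
chords: the sides of the polygon and the chords that do not run inside one string. `ChordSystem`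
collects the orientation facts needed, which hold both for subdivided polygons and for strictly
convex polygons with forbidden diagonals. `ChordSystem.dissects_iff_isTri` then replaces dissections
by the recursive objects `IsTri`, split at the triangle on the base.

For an open chain of strings, the strictly upper triangular matrix G of the numbers of
triangulations satisfies G = Y + G², where Y has an entry 1 for each side and -1 for each chord that
skips one interior vertex of a string (`triCount_chain`). As Y is nilpotent, G = ∑ C_N Y^(N+1) with
Catalan numbers C_N. Powers of Y count signed paths. No step jumps over a corner, so the generating
function of the paths is a product with one factor p_r(x) = `sidePoly x r` per string
(`pathSum_eq_sidePoly`). Closing the chain to a ring loses a single term (`triCount_ring`), and the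
count becomes the value of p_r(x)^k / x² under x^N ↦ C_N (`exists_catalan_expansion`). For k = 1 the
given alternating sum is this same evaluation (`single_string_expansion`).

Finally, with x = 4/(1+4u²) one has π C_N = ∫ u² x^(N+2) du (`integral_catalanKernel`), so the count
is 1/π times ∫ u² p_r(x)^k du. The recurrence of p_r has the characteristic roots 2/(1-2iu) and
2/(1+2iu), and the resulting Binet formula gives the stated integrand (`saddleIntegrand_eq`). -/

lemma orient_rotate (p q s : Plane) : orient q s p = orient p q s := by
  simp only [orient]; ring

lemma orient_swap (p q s : Plane) : orient p s q = -orient p q s := by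
  simp only [orient]; ring

@[simp] lemma orient_self_left (p q : Plane) : orient p q p = 0 := by
  simp only [orient]; ring

@[simp] lemma orient_self_right (p q : Plane) : orient p q q = 0 := by
  simp only [orient]; ring

@[simp] lemma orient_same (p q : Plane) : orient p p q = 0 := by
  simp only [orient]; ring

lemma orient_combo₂ (p q x y : Plane) {a b : ℝ} (h : a + b = 1) :
    orient p q (a • x + b • y) = a * orient p q x + b * orient p q y := by
  obtain rfl : b = 1 - a := by linarith
  simp only [orient, PiLp.add_apply, PiLp.smul_apply, smul_eq_mul]; ring

lemma orient_combo₃ (p q x y z : Plane) {a b c : ℝ} (h : a + b + c = 1) :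
    orient p q (a • x + b • y + c • z) =
      a * orient p q x + b * orient p q y + c * orient p q z := by
  obtain rfl : c = 1 - a - b := by linarith
  simp only [orient, PiLp.add_apply, PiLp.smul_apply, smul_eq_mul]; ring

lemma convex_orient_nonneg (p q : Plane) : Convex ℝ {x | 0 ≤ orient p q x} := by
  intro x hx y hy a b ha hb hab
  simp only [Set.mem_ofPred_eq] at *
  rw [orient_combo₂ _ _ _ _ hab]
  positivity

lemma convex_orient_nonpos (p q : Plane) : Convex ℝ {x | orient p q x ≤ 0} := by
  intro x hx y hy a b ha hb hab
  simp only [Set.mem_ofPred_eq] at *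
  rw [orient_combo₂ _ _ _ _ hab]
  nlinarith

lemma mem_convexHull_triple {p q s x : Plane} (hx : x ∈ convexHull ℝ {p, q, s}) :
    ∃ a b c : ℝ, 0 ≤ a ∧ 0 ≤ b ∧ 0 ≤ c ∧ a + b + c = 1 ∧ x = a • p + b • q + c • s := by
  rw [convexHull_insert (by simp), convexHull_pair] at hx
  simp only [convexJoin_singleton_left, Set.mem_iUnion] at hx
  obtain ⟨y, ⟨b, c, hb, hc, hbc, rfl⟩, ⟨a, d, ha, hd, had, rfl⟩⟩ := hx
  refine ⟨a, d * b, d * c, ha, by positivity, by positivity, ?_, ?_⟩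
  · rw [add_assoc, ← mul_add, hbc, mul_one, had]
  · rw [smul_add, smul_smul, smul_smul, add_assoc]

lemma triple_mem_convexHull {p q s : Plane} {a b c : ℝ} (ha : 0 ≤ a) (hb : 0 ≤ b) (hc : 0 ≤ c)
    (h : a + b + c = 1) : a • p + b • q + c • s ∈ convexHull ℝ {p, q, s} := by
  have hconv := convex_convexHull ℝ ({p, q, s} : Set Plane)
  have hs := subset_convexHull ℝ ({p, q, s} : Set Plane)
  have := hconv.sum_mem (t := Finset.univ) (w := ![a, b, c]) (z := ![p, q, s])
    (by intro i _; fin_cases i <;> simpa) (by simpa [Fin.sum_univ_three] using h)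
    (by intro i _; fin_cases i <;> exact hs (by simp))
  simpa [Fin.sum_univ_three] using this

/-- A triangle is the intersection of the half planes to the left of its sides. -/
lemma mem_convexHull_of_orient {p q s x : Plane} (hD : 0 < orient p q s)
    (h₁ : 0 ≤ orient p q x) (h₂ : 0 ≤ orient q s x) (h₃ : 0 ≤ orient s p x) :
    x ∈ convexHull ℝ {p, q, s} := by
  -- The barycentric coordinates of `x` are the areas of the triangles it spans with the sides,
  -- divided by the area of `p q s`.
  have hsum : orient q s x / orient p q s + orient s p x / orient p q s +
      orient p q x / orient p q s = 1 := by
    rw [← add_div, ← add_div, div_eq_one_iff_eq hD.ne']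
    simp only [orient]; ring
  have hx : x = (orient q s x / orient p q s) • p + (orient s p x / orient p q s) • q +
      (orient p q x / orient p q s) • s := by
    ext i
    simp only [PiLp.add_apply, PiLp.smul_apply, smul_eq_mul]
    have hD' := hD.ne'
    field_simp
    simp only [orient]
    fin_cases i <;> simp <;> ring
  rw [hx]
  exact triple_mem_convexHull (by positivity) (by positivity) (by positivity) hsum

/-- Sets on different sides of a line have disjoint interiors. -/
lemma disjoint_interior_of_orient {p q s : Plane} (hs : orient p q s ≠ 0) {A B : Set Plane}
    (hA : ∀ x ∈ A, orient p q x ≤ 0) (hB : ∀ x ∈ B, 0 ≤ orient p q x) :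
    Disjoint (interior A) (interior B) := by
  rw [Set.disjoint_left]
  intro x hxA hxB
  have hopen : IsOpen (interior A ∩ interior B) := isOpen_interior.inter isOpen_interior
  -- A common interior point lies on the line; moving it slightly in the direction `s - p`,
  -- transversal to the line, would keep it in both sets.
  have hcont : Continuous fun t : ℝ => x + t • (s - p) := by fun_prop
  have h0 : ∀ᶠ t in nhds (0 : ℝ), x + t • (s - p) ∈ interior A ∩ interior B :=
    hcont.continuousAt.eventually (hopen.mem_nhds (by simpa using ⟨hxA, hxB⟩))
  have h1 : ∀ᶠ t in nhdsWithin (0 : ℝ) {0}ᶜ, x + t • (s - p) ∈ interior A ∩ interior B :=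
    h0.filter_mono nhdsWithin_le_nhds
  obtain ⟨t, ht, ht0⟩ := (h1.and self_mem_nhdsWithin).exists
  have e0 : orient p q x = 0 :=
    le_antisymm (hA _ (interior_subset hxA)) (hB _ (interior_subset hxB))
  have e1 : orient p q (x + t • (s - p)) = 0 :=
    le_antisymm (hA _ (interior_subset ht.1)) (hB _ (interior_subset ht.2))
  have e2 : orient p q (x + t • (s - p)) = orient p q x + t * orient p q s := by
    simp only [orient, PiLp.add_apply, PiLp.smul_apply, PiLp.sub_apply, smul_eq_mul]; ring
  rw [e1, e0, zero_add] at e2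
  exact mul_ne_zero ht0 hs e2.symm

lemma interior_convexHull_nonempty_of_orient {p q s : Plane} (hD : 0 < orient p q s) :
    (interior (convexHull ℝ {p, q, s})).Nonempty := by
  set x : Plane := (1 / 3 : ℝ) • p + (1 / 3 : ℝ) • q + (1 / 3 : ℝ) • s with hx
  have h3 : (1 / 3 : ℝ) + 1 / 3 + 1 / 3 = 1 := by norm_num
  have c : ∀ a b : Plane, Continuous fun y : Plane => orient a b y := by
    intro a b; unfold orient; fun_prop
  refine ⟨x, mem_interior.mpr ⟨{y | 0 < orient p q y} ∩ ({y | 0 < orient q s y} ∩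
    {y | 0 < orient s p y}), ?_, ?_, ?_⟩⟩
  · rintro y ⟨h₁, h₂, h₃⟩
    exact mem_convexHull_of_orient hD (le_of_lt h₁) (le_of_lt h₂) (le_of_lt h₃)
  · exact (isOpen_lt continuous_const (c _ _)).inter
      ((isOpen_lt continuous_const (c _ _)).inter (isOpen_lt continuous_const (c _ _)))
  · have r1 := orient_rotate p q s
    have r2 := orient_rotate q s p
    refine ⟨?_, ?_, ?_⟩ <;> simp only [Set.mem_ofPred_eq, hx, orient_combo₃ _ _ _ _ _ h3] <;>
      simp <;> linarith

/-- Triangles with disjoint interiors are separated by a line. -/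
lemma exists_separation {p q s p' q' s' : Plane} (hD : 0 < orient p q s)
    (hD' : 0 < orient p' q' s')
    (h : Disjoint (interior (convexHull ℝ {p, q, s})) (interior (convexHull ℝ {p', q', s'}))) :
    ∃ u v w : ℝ, (u ≠ 0 ∨ v ≠ 0) ∧
      (∀ x ∈ ({p, q, s} : Set Plane), u * x 0 + v * x 1 ≤ w) ∧
      (∀ x ∈ ({p', q', s'} : Set Plane), w ≤ u * x 0 + v * x 1) := by
  have n₁ := interior_convexHull_nonempty_of_orient hD
  have n₂ := interior_convexHull_nonempty_of_orient hD'
  have c₁ := convex_convexHull ℝ ({p, q, s} : Set Plane)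
  have c₂ := convex_convexHull ℝ ({p', q', s'} : Set Plane)
  obtain ⟨f, w, hf₁, hf₂⟩ := geometric_hahn_banach_open_open c₁.interior isOpen_interior
    c₂.interior isOpen_interior h
  have hf : ∀ x : Plane, f x = f (EuclideanSpace.single 0 1) * x 0 +
      f (EuclideanSpace.single 1 1) * x 1 := by
    intro x
    have hx : x = x 0 • EuclideanSpace.single 0 (1 : ℝ) + x 1 • EuclideanSpace.single 1 (1 : ℝ) := by
      ext i; fin_cases i <;> simp
    conv_lhs => rw [hx]
    simp only [map_add, map_smul, smul_eq_mul]; ring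
  refine ⟨f (EuclideanSpace.single 0 1), f (EuclideanSpace.single 1 1), w, ?_, ?_, ?_⟩
  · by_contra hcon
    push Not at hcon
    obtain ⟨x, hx⟩ := n₁
    obtain ⟨y, hy⟩ := n₂
    have hx' := hf₁ x hx
    have hy' := hf₂ y hy
    rw [hf, hcon.1, hcon.2] at hx' hy'
    linarith
  · intro x hx
    rw [← hf]
    -- Only the interiors are separated strictly; a vertex is a limit of interior points, hence
    -- satisfies the weak inequality.
    have hcl : x ∈ closure (interior (convexHull ℝ {p, q, s})) := by
      rw [c₁.closure_interior_eq_closure_of_nonempty_interior n₁]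
      exact subset_closure (subset_convexHull ℝ _ hx)
    exact closure_minimal (t := {y | f y ≤ w}) (fun y hy => (hf₁ y hy).le)
      (isClosed_le f.continuous continuous_const) hcl
  · intro x hx
    rw [← hf]
    have hcl : x ∈ closure (interior (convexHull ℝ {p', q', s'})) := by
      rw [c₂.closure_interior_eq_closure_of_nonempty_interior n₂]
      exact subset_closure (subset_convexHull ℝ _ hx)
    exact closure_minimal (t := {y | w ≤ f y}) (fun y hy => (hf₂ y hy).le)
      (isClosed_le continuous_const f.continuous) hcl

lemma orient_eq_zero_of_collinear {p q s : Plane} {u v w : ℝ} (h : u ≠ 0 ∨ v ≠ 0)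
    (hp : u * p 0 + v * p 1 = w) (hq : u * q 0 + v * q 1 = w) (hs : u * s 0 + v * s 1 = w) :
    orient p q s = 0 := by
  have h1 : u * orient p q s = 0 := by
    simp only [orient]
    linear_combination (s 1 - p 1) * (hq - hp) - (q 1 - p 1) * (hs - hp)
  have h2 : v * orient p q s = 0 := by
    simp only [orient]
    linear_combination (q 0 - p 0) * (hs - hp) - (s 0 - p 0) * (hq - hp)
  rcases h with h | h
  · exact (mul_eq_zero.mp h1).resolve_left h
  · exact (mul_eq_zero.mp h2).resolve_left h

/-- The diagonals of a convex quadrilateral cannot be weakly separated by a line. -/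
lemma not_separated_diagonals {p₀ p₁ p₂ p₃ : Plane} {u v w : ℝ} (h : u ≠ 0 ∨ v ≠ 0)
    (h₀ : 0 < orient p₁ p₂ p₃) (h₁ : 0 < orient p₀ p₂ p₃) (h₂ : 0 < orient p₀ p₁ p₃)
    (h₃ : 0 < orient p₀ p₁ p₂)
    (g₀ : u * p₀ 0 + v * p₀ 1 ≤ w) (g₂ : u * p₂ 0 + v * p₂ 1 ≤ w)
    (g₁ : w ≤ u * p₁ 0 + v * p₁ 1) (g₃ : w ≤ u * p₃ 0 + v * p₃ 1) : False := by
  -- The affine dependence of four points of the plane, with areas as coefficients. All four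
  -- summands are nonnegative, so all vanish and the vertices would be collinear.
  have key : orient p₁ p₂ p₃ * (w - (u * p₀ 0 + v * p₀ 1)) +
      orient p₀ p₁ p₃ * (w - (u * p₂ 0 + v * p₂ 1)) +
      orient p₀ p₂ p₃ * ((u * p₁ 0 + v * p₁ 1) - w) +
      orient p₀ p₁ p₂ * ((u * p₃ 0 + v * p₃ 1) - w) = 0 := by
    simp only [orient]; ring
  have a₀ := mul_nonneg h₀.le (sub_nonneg.mpr g₀)
  have a₁ := mul_nonneg h₁.le (sub_nonneg.mpr g₁)
  have a₂ := mul_nonneg h₂.le (sub_nonneg.mpr g₂)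
  have a₃ := mul_nonneg h₃.le (sub_nonneg.mpr g₃)
  have b₀ : w - (u * p₀ 0 + v * p₀ 1) = 0 :=
    (mul_eq_zero.mp (by linarith : orient p₁ p₂ p₃ * _ = 0)).resolve_left h₀.ne'
  have b₁ : u * p₁ 0 + v * p₁ 1 - w = 0 :=
    (mul_eq_zero.mp (by linarith : orient p₀ p₂ p₃ * _ = 0)).resolve_left h₁.ne'
  have b₂ : w - (u * p₂ 0 + v * p₂ 1) = 0 :=
    (mul_eq_zero.mp (by linarith : orient p₀ p₁ p₃ * _ = 0)).resolve_left h₂.ne'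
  have := orient_eq_zero_of_collinear (p := p₀) (q := p₁) (s := p₂) (w := w) h
    (by linarith) (by linarith) (by linarith)
  linarith

/-- Two triangles on the same side of a common base cannot be weakly separated by a line. -/
lemma not_separated_same_base {p q b m : Plane} {u v w : ℝ} (h : u ≠ 0 ∨ v ≠ 0)
    (hb : 0 < orient p b q) (hm : 0 < orient p m q)
    (gp : u * p 0 + v * p 1 = w) (gq : u * q 0 + v * q 1 = w)
    (gb : u * b 0 + v * b 1 ≤ w) (gm : w ≤ u * m 0 + v * m 1) : False := by
  -- An affine function that vanishes at `p` and `q` is proportional to the signed distance from the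
  -- line `p q`, so it has the same sign at `b` and `m`.
  have key : (u * b 0 + v * b 1 - w) * orient p m q = (u * m 0 + v * m 1 - w) * orient p b q := by
    simp only [orient]
    linear_combination ((b 0 - p 0) * (m 1 - p 1) - (b 1 - p 1) * (m 0 - p 0)) * (gp - gq)
      + ((m 0 - p 0) * (q 1 - p 1) - (m 1 - p 1) * (q 0 - p 0)
        - (b 0 - p 0) * (q 1 - p 1) + (b 1 - p 1) * (q 0 - p 0)) * gp
  have a₁ := mul_nonneg hm.le (sub_nonneg.mpr gb)
  have a₂ := mul_nonneg hb.le (sub_nonneg.mpr gm)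
  have b₁ : (u * m 0 + v * m 1 - w) = 0 :=
    (mul_eq_zero.mp (by nlinarith : orient p b q * _ = 0)).resolve_left hb.ne'
  have := orient_eq_zero_of_collinear (p := p) (q := m) (s := q) (w := w) h gp (by linarith) gq
  linarith

/-! ### Triangulations of a chord system -/

/-- The points `q 0, …, q (n-1)` are the vertices, in counterclockwise order, of a convex polygon,
whose angles may be straight, and `L a b` (for `a < b < n`) says that the side or diagonal from
`q a` to `q b` is legal. Three vertices are not collinear as soon as two of them span a legal
diagonal that is not a side. -/
structure ChordSystem (n : ℕ) (q : ℕ → Plane) (L : ℕ → ℕ → Prop) : Prop where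
  side : ∀ a, a + 1 < n → L a (a + 1)
  orient_nonneg : ∀ a b c, a < b → b < c → c < n → 0 ≤ orient (q a) (q b) (q c)
  orient_pos_left : ∀ a b c, a + 1 < b → b < c → c < n → L a b → 0 < orient (q a) (q b) (q c)
  orient_pos_right : ∀ a b c, a < b → b + 1 < c → c < n → L b c → 0 < orient (q a) (q b) (q c)
  -- The chord from `0` to `n - 1` is a side of the polygon and may be collinear with further
  -- vertices; `orient_pos_root` takes its place.
  orient_pos_mid : ∀ a b c, a < b → b < c → c < n → (a ≠ 0 ∨ c + 1 ≠ n) → L a c →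
    0 < orient (q a) (q b) (q c)
  orient_pos_root : ∀ b, 0 < b → b + 1 < n → L 0 b → 0 < orient (q 0) (q b) (q (n - 1))
  orient_pos : ∀ a b c, a < b → b < c → c < n → L a b → L b c → L a c →
    0 < orient (q a) (q b) (q c)

/-- The closed triangle spanned by three of the points. -/
def tri (q : ℕ → Plane) (t : ℕ × ℕ × ℕ) : Set Plane := convexHull ℝ {q t.1, q t.2.1, q t.2.2}

/-- The triangle `t` has its vertices in the interval from `i` to `j`, and its sides are legal. -/
structure LegalTriangle (L : ℕ → ℕ → Prop) (i j : ℕ) (t : ℕ × ℕ × ℕ) : Prop where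
  le_left : i ≤ t.1
  lt_mid : t.1 < t.2.1
  mid_lt : t.2.1 < t.2.2
  right_le : t.2.2 ≤ j
  legal_left : L t.1 t.2.1
  legal_right : L t.2.1 t.2.2
  legal : L t.1 t.2.2

/-- `T` dissects the polygon with the vertices `q i, …, q j` into legal triangles. -/
structure Dissects (q : ℕ → Plane) (L : ℕ → ℕ → Prop) (i j : ℕ)
    (T : Finset (ℕ × ℕ × ℕ)) : Prop where
  legal : ∀ t ∈ T, LegalTriangle L i j t
  disjoint : ∀ s ∈ T, ∀ t ∈ T, s ≠ t → Disjoint (interior (tri q s)) (interior (tri q t))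
  -- For `j = i + 1` the hull is a segment, which the empty dissection does not cover.
  cover : i + 2 ≤ j → convexHull ℝ (q '' Set.Icc i j) ⊆ ⋃ t ∈ T, tri q t

/-- The combinatorial triangulations of the polygon with the vertices `i, …, j`. -/
inductive IsTri (L : ℕ → ℕ → Prop) : ℕ → ℕ → Finset (ℕ × ℕ × ℕ) → Prop
  | side (i : ℕ) : IsTri L i (i + 1) ∅
  | join {i m j : ℕ} {A B : Finset (ℕ × ℕ × ℕ)} (h : L i j) (hA : IsTri L i m A)
      (hB : IsTri L m j B) : IsTri L i j (insert (i, m, j) (A ∪ B))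

lemma IsTri.lt {L : ℕ → ℕ → Prop} {i j : ℕ} {T : Finset (ℕ × ℕ × ℕ)} (h : IsTri L i j T) :
    i < j := by
  induction h with
  | side i => omega
  | join _ _ _ h₁ h₂ => omega

lemma LegalTriangle.mono {L : ℕ → ℕ → Prop} {i j i' j' : ℕ} {t : ℕ × ℕ × ℕ}
    (h : LegalTriangle L i j t) (hi : i' ≤ i) (hj : j ≤ j') : LegalTriangle L i' j' t :=
  { h with le_left := hi.trans h.le_left, right_le := h.right_le.trans hj }

lemma tri_subset {q : ℕ → Plane} {t : ℕ × ℕ × ℕ} {C : Set Plane} (hC : Convex ℝ C)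
    (h₁ : q t.1 ∈ C) (h₂ : q t.2.1 ∈ C) (h₃ : q t.2.2 ∈ C) : tri q t ⊆ C := by
  refine convexHull_min ?_ hC
  rintro x (rfl | rfl | rfl) <;> assumption

lemma tri_orient_nonneg {q : ℕ → Plane} {t : ℕ × ℕ × ℕ} {p s : Plane}
    (h₁ : 0 ≤ orient p s (q t.1)) (h₂ : 0 ≤ orient p s (q t.2.1)) (h₃ : 0 ≤ orient p s (q t.2.2)) :
    ∀ x ∈ tri q t, 0 ≤ orient p s x :=
  tri_subset (convex_orient_nonneg p s) h₁ h₂ h₃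

/-- A point on a line that bounds a convex set on which a closed set covers everything off the line
is covered as well. -/
lemma subset_of_isClosed_of_orient {K C : Set Plane} (hK : Convex ℝ K) (hC : IsClosed C)
    {p s z : Plane} (hz : z ∈ K) (hneg : orient p s z < 0) (hle : ∀ x ∈ K, orient p s x ≤ 0)
    (h : ∀ x ∈ K, orient p s x < 0 → x ∈ C) : K ⊆ C := by
  intro x hx
  have hcont : Continuous fun t : ℝ => (1 - t) • x + t • z := by fun_prop
  have hmem : ∀ t ∈ Set.Ioc (0 : ℝ) 1, (1 - t) • x + t • z ∈ C := by
    rintro t ⟨h0, h1⟩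
    refine h _ (hK hx hz (by linarith) h0.le (by ring)) ?_
    rw [orient_combo₂ _ _ _ _ (by ring)]
    nlinarith [hle x hx]
  have : (fun t : ℝ => (1 - t) • x + t • z) 0 ∈ C := by
    have h0 : (0 : ℝ) ∈ closure (Set.Ioc (0 : ℝ) 1) := by
      rw [closure_Ioc (by norm_num)]; simp
    exact closure_minimal (t := (fun t : ℝ => (1 - t) • x + t • z) ⁻¹' C) hmem
      (hC.preimage hcont) h0
  simpa using this

/-! ### Geometric dissections are combinatorial triangulations -/

namespace ChordSystem

variable {n : ℕ} {q : ℕ → Plane} {L : ℕ → ℕ → Prop}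

lemma orient_pos_of_legal (S : ChordSystem n q L) {i j : ℕ} (hj : j < n) {t : ℕ × ℕ × ℕ}
    (h : LegalTriangle L i j t) : 0 < orient (q t.1) (q t.2.1) (q t.2.2) :=
  S.orient_pos _ _ _ h.lt_mid h.mid_lt (h.right_le.trans_lt hj) h.legal_left h.legal_right h.legal

lemma orient_nonneg' (S : ChordSystem n q L) {a b c : ℕ} (hab : a ≤ b) (hbc : b ≤ c) (hc : c < n) :
    0 ≤ orient (q a) (q b) (q c) := by
  rcases hab.eq_or_lt with rfl | hab
  · simp
  rcases hbc.eq_or_lt with rfl | hbc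
  · simp
  exact S.orient_nonneg _ _ _ hab hbc hc

lemma orient_nonpos_outer (S : ChordSystem n q L) {i j : ℕ} (hj : j < n) {m : ℕ}
    (h₁ : i ≤ m) (h₂ : m ≤ j) : orient (q i) (q j) (q m) ≤ 0 := by
  rw [orient_swap]
  linarith [S.orient_nonneg' h₁ h₂ hj]

lemma orient_nonneg_after (S : ChordSystem n q L) {i j : ℕ} {m : ℕ} (hij : i ≤ j)
    (h₁ : j ≤ m) (h₂ : m < n) : 0 ≤ orient (q i) (q j) (q m) := S.orient_nonneg' hij h₁ h₂

lemma orient_nonneg_before (S : ChordSystem n q L) {i j : ℕ} {m : ℕ} (hij : i ≤ j)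
    (h₁ : m ≤ i) (h₂ : j < n) : 0 ≤ orient (q i) (q j) (q m) := by
  rw [orient_rotate]; exact S.orient_nonneg' h₁ hij h₂

/-- Every vertex that is joined to `i` is off the line of the legal base from `i` to `j`. -/
lemma orient_pos_base (S : ChordSystem n q L) {i b j : ℕ} (hib : i < b) (hbj : b < j) (hj : j < n)
    (hij : L i j) (hb : L i b) : 0 < orient (q i) (q b) (q j) := by
  by_cases h : i ≠ 0 ∨ j + 1 ≠ n
  · exact S.orient_pos_mid _ _ _ hib hbj hj h hij
  · push Not at h
    obtain ⟨rfl, rfl⟩ := h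
    simpa using S.orient_pos_root b hib (by omega) hb

/-- A dissection of a polygon contains a triangle on its base. -/
lemma exists_base_triangle (S : ChordSystem n q L) {i j : ℕ} (hij : i + 2 ≤ j) (hj : j < n)
    (hL : L i j) {T : Finset (ℕ × ℕ × ℕ)} (hT : Dissects q L i j T) : ∃ m, (i, m, j) ∈ T := by
  set y : Plane := (1 / 2 : ℝ) • q i + (1 / 2 : ℝ) • q j with hy
  have hhalf : (1 / 2 : ℝ) + 1 / 2 = 1 := by norm_num
  have hyK : y ∈ convexHull ℝ (q '' Set.Icc i j) :=
    (convex_convexHull ℝ _) (subset_convexHull ℝ _ (Set.mem_image_of_mem q (Set.mem_Icc.mpr ⟨le_rfl, by omega⟩)))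
      (subset_convexHull ℝ _ (Set.mem_image_of_mem q (Set.mem_Icc.mpr ⟨by omega, le_rfl⟩))) (by norm_num) (by norm_num) hhalf
  have hcov := hT.cover hij hyK
  simp only [Set.mem_iUnion] at hcov
  obtain ⟨⟨a, b, c⟩, ht, hyt⟩ := hcov
  have ht' := hT.legal _ ht
  obtain ⟨hia, hab, hbc, hcj, hLab, hLbc, hLac⟩ := ht'
  simp only at hia hab hbc hcj hLab hLbc hLac
  have hpos : 0 < orient (q i) (q (i + 1)) (q j) :=
    S.orient_pos_base (by omega) (by omega) hj hL (S.side _ (by omega))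
  -- The triangle sought is one that contains the midpoint `y` of the base. If it avoided `q i`, it
  -- would lie beyond the line from `q (i + 1)` to `q j`, which has `y` strictly on its other side.
  have hai : a = i := by
    by_contra hne
    have hsub : tri q (a, b, c) ⊆ {x | orient (q (i + 1)) (q j) x ≤ 0} :=
      tri_subset (convex_orient_nonpos _ _) (S.orient_nonpos_outer hj (by simp; omega) (by simp; omega))
        (S.orient_nonpos_outer hj (by simp; omega) (by simp; omega))
        (S.orient_nonpos_outer hj (by simp; omega) (by simp; omega))
    have h1 : orient (q (i + 1)) (q j) y ≤ 0 := hsub hyt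
    rw [hy, orient_combo₂ _ _ _ _ hhalf, orient_rotate] at h1
    simp at h1
    linarith
  subst hai
  refine ⟨b, ?_⟩
  rcases hcj.eq_or_lt with rfl | hcj
  · exact ht
  exfalso
  -- If `c ≠ j`, then both `q b` and `q c` are strictly off the base line while `y` is on it. This
  -- forces their weights to vanish and `y` to be the endpoint `q a`.
  have h2 : 0 < orient (q a) (q b) (q j) := S.orient_pos_base hab (by omega) hj hL hLab
  have h3 : 0 < orient (q a) (q c) (q j) := S.orient_pos_base (by omega) hcj hj hL hLac
  obtain ⟨α, β, γ, hα, hβ, hγ, hsum, hyeq⟩ := mem_convexHull_triple hyt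
  have h4 : orient (q a) (q j) y = 0 := by
    rw [hy, orient_combo₂ _ _ _ _ hhalf]; simp
  rw [hyeq, orient_combo₃ _ _ _ _ _ hsum, orient_swap _ (q b) (q j), orient_swap _ (q c) (q j)] at h4
  simp only [orient_self_left] at h4
  have hβ0 : β = 0 := by nlinarith [mul_nonneg hβ h2.le, mul_nonneg hγ h3.le]
  have hγ0 : γ = 0 := by nlinarith [mul_nonneg hβ h2.le, mul_nonneg hγ h3.le]
  have hα1 : α = 1 := by linarith
  simp only [hβ0, hγ0, hα1, one_smul, zero_smul, add_zero] at hyeq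
  have h5 : orient (q (a + 1)) (q j) y = 0 + 1 / 2 * orient (q (a + 1)) (q j) (q a) := by
    rw [hy, orient_combo₂ _ _ _ _ hhalf]; simp
  rw [hyeq, orient_rotate] at h5
  linarith

/-- A legal triangle disjoint from a triangle on the base lies on one side of the latter. -/
lemma le_or_le_of_disjoint (S : ChordSystem n q L) {i m j : ℕ} (hj : j < n)
    (ht : LegalTriangle L i j (i, m, j)) {s : ℕ × ℕ × ℕ} (hs : LegalTriangle L i j s)
    (hne : s ≠ (i, m, j)) (hd : Disjoint (interior (tri q s)) (interior (tri q (i, m, j)))) :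
    s.2.2 ≤ m ∨ m ≤ s.1 := by
  have hDs := S.orient_pos_of_legal hj hs
  have hDt := S.orient_pos_of_legal hj ht
  obtain ⟨u, v, w, huv, h₁, h₂⟩ := exists_separation hDs hDt hd
  obtain ⟨a, b, c⟩ := s
  obtain ⟨hia, hab, hbc, hcj, hLab, hLbc, hLac⟩ := hs
  obtain ⟨-, him, hmj, -, hLim, hLmj, hLij⟩ := ht
  simp only at hia hab hbc hcj hLab hLbc hLac him hmj hLim hLmj hLij h₁ h₂ hDs hDt ⊢
  by_contra hcon
  push Not at hcon
  obtain ⟨hmc, ham⟩ := hcon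
  have ga := h₁ (q a) (by simp)
  have gb := h₁ (q b) (by simp)
  have gc := h₁ (q c) (by simp)
  have gi := h₂ (q i) (by simp)
  have gm := h₂ (q m) (by simp)
  have gj := h₂ (q j) (by simp)
  -- With `a < m < c`, either both triangles stand on the base, or a side of one crosses a side of
  -- the other: `i c` crosses `m j` if `a = i`, and `i m` crosses `a c` if `i < a`.
  rcases hia.eq_or_lt with rfl | hia
  · rcases hcj.eq_or_lt with rfl | hcj
    · exact not_separated_same_base huv hDs hDt (le_antisymm ga gi) (le_antisymm gc gj) gb gm
    · exact not_separated_diagonals huv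
        (S.orient_pos_mid m c j hmc hcj hj (by omega) hLmj)
        (S.orient_pos_left i c j (by omega) hcj hj hLac)
        (S.orient_pos_right i m j him (by omega) hj hLmj)
        (S.orient_pos_mid i m c him hmc (by omega) (by omega) hLac) ga gc gm gj
  · have huv' : -u ≠ 0 ∨ -v ≠ 0 := by simpa using huv
    exact not_separated_diagonals (w := -w) huv'
        (S.orient_pos_mid a m c ham hmc (by omega) (by omega) hLac)
        (S.orient_pos_left i m c (by omega) hmc (by omega) hLim)
        (S.orient_pos_right i a c hia (by omega) (by omega) hLac)
        (S.orient_pos_mid i a m hia ham (by omega) (by omega) hLim)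
        (by linarith) (by linarith) (by linarith) (by linarith)

lemma isClosed_iUnion_tri (q : ℕ → Plane) (T : Finset (ℕ × ℕ × ℕ)) :
    IsClosed (⋃ t ∈ T, tri q t) := by
  refine T.finite_toSet.isClosed_biUnion fun t _ => ?_
  have : ({q t.1, q t.2.1, q t.2.2} : Set Plane).Finite := by simp
  exact this.isClosed_convexHull _

/-- A dissection is cut into two by the triangle on its base. -/
lemma split_dissection (S : ChordSystem n q L) {i m j : ℕ} (hj : j < n)
    {T : Finset (ℕ × ℕ × ℕ)} (hT : Dissects q L i j T) (hm : (i, m, j) ∈ T) :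
    Dissects q L i m (T.filter fun t => t.2.2 ≤ m) ∧
    Dissects q L m j (T.filter fun t => m ≤ t.1) ∧
    T = insert (i, m, j) ((T.filter fun t => t.2.2 ≤ m) ∪ (T.filter fun t => m ≤ t.1)) := by
  have hleg := hT.legal _ hm
  have him : i < m := hleg.lt_mid
  have hmj : m < j := hleg.mid_lt
  have hcases : ∀ s ∈ T, s = (i, m, j) ∨ s.2.2 ≤ m ∨ m ≤ s.1 := by
    intro s hs
    by_cases h : s = (i, m, j)
    · exact Or.inl h
    · exact Or.inr (S.le_or_le_of_disjoint hj hleg (hT.legal _ hs) h (hT.disjoint _ hs _ hm h))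
  have himage : ∀ a b, i ≤ a → b ≤ j → q '' Set.Icc a b ⊆ q '' Set.Icc i j := fun a b h h' =>
    Set.image_mono (Set.Icc_subset_Icc h h')
  refine ⟨⟨?_, ?_, ?_⟩, ⟨?_, ?_, ?_⟩, ?_⟩
  · intro t ht
    rw [Finset.mem_filter] at ht
    exact { hT.legal _ ht.1 with right_le := ht.2 }
  · intro s hs t ht
    exact hT.disjoint _ (Finset.mem_filter.mp hs).1 _ (Finset.mem_filter.mp ht).1
  · intro h2
    have hp : 0 < orient (q i) (q (i + 1)) (q m) :=
      S.orient_pos_mid _ _ _ (by omega) (by omega) (by omega) (by omega) hleg.legal_left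
    -- A point strictly beyond the chord from `i` to `m` is in no triangle outside the left part,
    -- since those lie in the opposite closed half plane. Points on the chord follow by closedness,
    -- with `q (i + 1)` as a point off the line.
    refine subset_of_isClosed_of_orient (convex_convexHull ℝ _) (isClosed_iUnion_tri q _)
      (p := q i) (s := q m)
      (subset_convexHull ℝ _ ⟨i + 1, by simp; omega, rfl⟩) ?_ ?_ ?_
    · rw [orient_swap]; linarith
    · refine convexHull_min ?_ (convex_orient_nonpos _ _)
      rintro _ ⟨a, ⟨ha, ha'⟩, rfl⟩
      exact S.orient_nonpos_outer (by omega) ha ha'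
    · intro x hx hneg
      have hx' := hT.cover (by omega) (convexHull_mono (himage i m le_rfl hmj.le) hx)
      simp only [Set.mem_iUnion] at hx' ⊢
      obtain ⟨t, ht, hxt⟩ := hx'
      refine ⟨t, Finset.mem_filter.mpr ⟨ht, ?_⟩, hxt⟩
      by_contra hcon
      have hl := hT.legal _ ht
      have hl1 := hl.le_left
      have hl2 := hl.lt_mid
      have hl3 := hl.mid_lt
      have hl4 := hl.right_le
      have : tri q t ⊆ {x | 0 ≤ orient (q i) (q m) x} := by
        rcases hcases t ht with rfl | h | h
        · exact tri_subset (convex_orient_nonneg _ _) (by simp) (by simp)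
            (S.orient_nonneg_after him.le hmj.le hj)
        · exact absurd h hcon
        · exact tri_subset (convex_orient_nonneg _ _) (S.orient_nonneg_after him.le (by omega) (by omega))
            (S.orient_nonneg_after him.le (by omega) (by omega))
            (S.orient_nonneg_after him.le (by omega) (by omega))
      exact absurd (this hxt) (not_le.mpr hneg)
  · intro t ht
    rw [Finset.mem_filter] at ht
    exact { hT.legal _ ht.1 with le_left := ht.2 }
  · intro s hs t ht
    exact hT.disjoint _ (Finset.mem_filter.mp hs).1 _ (Finset.mem_filter.mp ht).1
  · intro h2
    have hp : 0 < orient (q m) (q (m + 1)) (q j) :=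
      S.orient_pos_mid _ _ _ (by omega) (by omega) (by omega) (by omega) hleg.legal_right
    refine subset_of_isClosed_of_orient (convex_convexHull ℝ _) (isClosed_iUnion_tri q _)
      (p := q m) (s := q j)
      (subset_convexHull ℝ _ ⟨m + 1, by simp; omega, rfl⟩) ?_ ?_ ?_
    · rw [orient_swap]; linarith
    · refine convexHull_min ?_ (convex_orient_nonpos _ _)
      rintro _ ⟨a, ⟨ha, ha'⟩, rfl⟩
      exact S.orient_nonpos_outer (by omega) ha ha'
    · intro x hx hneg
      have hx' := hT.cover (by omega) (convexHull_mono (himage m j him.le le_rfl) hx)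
      simp only [Set.mem_iUnion] at hx' ⊢
      obtain ⟨t, ht, hxt⟩ := hx'
      refine ⟨t, Finset.mem_filter.mpr ⟨ht, ?_⟩, hxt⟩
      by_contra hcon
      have hl := hT.legal _ ht
      have hl1 := hl.le_left
      have hl2 := hl.lt_mid
      have hl3 := hl.mid_lt
      have hl4 := hl.right_le
      have : tri q t ⊆ {x | 0 ≤ orient (q m) (q j) x} := by
        rcases hcases t ht with rfl | h | h
        · exact tri_subset (convex_orient_nonneg _ _)
            (S.orient_nonneg_before hmj.le him.le hj) (by simp) (by simp)
        · exact tri_subset (convex_orient_nonneg _ _) (S.orient_nonneg_before hmj.le (by omega) hj)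
            (S.orient_nonneg_before hmj.le (by omega) hj)
            (S.orient_nonneg_before hmj.le (by omega) hj)
        · exact absurd h hcon
      exact absurd (this hxt) (not_le.mpr hneg)
  · ext s
    simp only [Finset.mem_insert, Finset.mem_union, Finset.mem_filter]
    constructor
    · intro hs
      rcases hcases s hs with h | h | h
      · exact Or.inl h
      · exact Or.inr (Or.inl ⟨hs, h⟩)
      · exact Or.inr (Or.inr ⟨hs, h⟩)
    · rintro (rfl | h | h)
      exacts [hm, h.1, h.1]

lemma isTri_of_dissects (S : ChordSystem n q L) : ∀ (d i j : ℕ), j - i = d → i < j → j < n →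
    L i j → ∀ T, Dissects q L i j T → IsTri L i j T := by
  intro d
  induction d using Nat.strong_induction_on with
  | _ d ih =>
    intro i j hd hij hj hL T hT
    by_cases h2 : i + 2 ≤ j
    · obtain ⟨m, hm⟩ := S.exists_base_triangle h2 hj hL hT
      have hleg := hT.legal _ hm
      have him : i < m := hleg.lt_mid
      have hmj : m < j := hleg.mid_lt
      obtain ⟨hA, hB, hE⟩ := S.split_dissection hj hT hm
      rw [hE]
      exact IsTri.join hL (ih _ (by omega) i m rfl him (by omega) hleg.legal_left _ hA)
        (ih _ (by omega) m j rfl hmj (by omega) hleg.legal_right _ hB)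
    · obtain rfl : j = i + 1 := by omega
      obtain rfl : T = ∅ := by
        rw [Finset.eq_empty_iff_forall_notMem]
        intro t ht
        have hl := hT.legal _ ht
        have hl1 := hl.le_left
        have hl2 := hl.lt_mid
        have hl3 := hl.mid_lt
        have hl4 := hl.right_le
        omega
      exact IsTri.side i

lemma isTri_legal (S : ChordSystem n q L) {i j : ℕ} {T : Finset (ℕ × ℕ × ℕ)} (h : IsTri L i j T)
    (hj : j < n) : L i j ∧ ∀ t ∈ T, LegalTriangle L i j t := by
  induction h with
  | side i => exact ⟨S.side _ hj, by simp⟩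
  | @join i m j A B h hA hB ihA ihB =>
    have h1 := hA.lt
    have h2 := hB.lt
    obtain ⟨hLA, ihA⟩ := ihA (by omega)
    obtain ⟨hLB, ihB⟩ := ihB hj
    refine ⟨h, ?_⟩
    intro t ht
    simp only [Finset.mem_insert, Finset.mem_union] at ht
    rcases ht with rfl | ht | ht
    · exact ⟨le_rfl, h1, h2, le_rfl, hLA, hLB, h⟩
    · exact (ihA t ht).mono le_rfl h2.le
    · exact (ihB t ht).mono h1.le le_rfl

/-- The line through `q i` and `q m` separates the left part from everything else, and the line
through `q m` and `q j` separates the right part from the base triangle. -/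
lemma isTri_disjoint (S : ChordSystem n q L) {i j : ℕ} {T : Finset (ℕ × ℕ × ℕ)} (h : IsTri L i j T)
    (hj : j < n) :
    ∀ s ∈ T, ∀ t ∈ T, s ≠ t → Disjoint (interior (tri q s)) (interior (tri q t)) := by
  induction h with
  | side i => simp
  | @join i m j A B h hA hB ihA ihB =>
    have h1 := hA.lt
    have h2 := hB.lt
    obtain ⟨hLA, lA⟩ := S.isTri_legal hA (by omega)
    obtain ⟨hLB, lB⟩ := S.isTri_legal hB hj
    have hD : 0 < orient (q i) (q m) (q j) := S.orient_pos _ _ _ h1 h2 hj hLA hLB h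
    have sideA : ∀ s ∈ A, ∀ x ∈ tri q s, orient (q i) (q m) x ≤ 0 := by
      intro s hs
      have hl := lA s hs
      have hl1 := hl.le_left
      have hl2 := hl.lt_mid
      have hl3 := hl.mid_lt
      have hl4 := hl.right_le
      exact tri_subset (convex_orient_nonpos _ _) (S.orient_nonpos_outer (by omega) (by omega) (by omega))
        (S.orient_nonpos_outer (by omega) (by omega) (by omega))
        (S.orient_nonpos_outer (by omega) (by omega) (by omega))
    have sideA' : ∀ t ∈ insert (i, m, j) B, ∀ x ∈ tri q t, 0 ≤ orient (q i) (q m) x := by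
      intro t ht
      rcases Finset.mem_insert.mp ht with rfl | ht
      · exact tri_orient_nonneg (by simp) (by simp) hD.le
      · have hl := lB t ht
        have hl1 := hl.le_left
        have hl2 := hl.lt_mid
        have hl3 := hl.mid_lt
        have hl4 := hl.right_le
        exact tri_subset (convex_orient_nonneg _ _)
          (S.orient_nonneg_after (by omega) (by omega) (by omega))
          (S.orient_nonneg_after (by omega) (by omega) (by omega))
          (S.orient_nonneg_after (by omega) (by omega) (by omega))
    have sideB : ∀ s ∈ B, ∀ x ∈ tri q s, orient (q m) (q j) x ≤ 0 := by
      intro s hs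
      have hl := lB s hs
      have hl1 := hl.le_left
      have hl2 := hl.lt_mid
      have hl3 := hl.mid_lt
      have hl4 := hl.right_le
      exact tri_subset (convex_orient_nonpos _ _) (S.orient_nonpos_outer (by omega) (by omega) (by omega))
        (S.orient_nonpos_outer (by omega) (by omega) (by omega))
        (S.orient_nonpos_outer (by omega) (by omega) (by omega))
    have sideB' : ∀ x ∈ tri q (i, m, j), 0 ≤ orient (q m) (q j) x :=
      tri_orient_nonneg (by rw [orient_rotate]; exact hD.le) (by simp) (by simp)
    have dA : ∀ s ∈ A, ∀ t ∈ insert (i, m, j) B,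
        Disjoint (interior (tri q s)) (interior (tri q t)) := fun s hs t ht =>
      disjoint_interior_of_orient hD.ne' (sideA s hs) (sideA' t ht)
    have dB : ∀ s ∈ B, Disjoint (interior (tri q s)) (interior (tri q (i, m, j))) := fun s hs =>
      disjoint_interior_of_orient (s := q i) (by rw [orient_rotate]; exact hD.ne')
        (sideB s hs) sideB'
    intro s hs t ht hne
    simp only [Finset.mem_insert, Finset.mem_union] at hs ht
    rcases hs with rfl | hs | hs <;> rcases ht with rfl | ht | ht
    · exact absurd rfl hne
    · exact (dA t ht _ (by simp)).symm
    · exact (dB t ht).symm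
    · exact dA s hs _ (by simp)
    · exact ihA (by omega) s hs t ht hne
    · exact dA s hs t (by simp [ht])
    · exact dB s hs
    · exact (dA t ht s (by simp [hs])).symm
    · exact ihB hj s hs t ht hne

/-- The triangles of a combinatorial triangulation cover the intersection of the half planes to the
left of the sides of the polygon. -/
lemma isTri_cover (S : ChordSystem n q L) {i j : ℕ} {T : Finset (ℕ × ℕ × ℕ)} (h : IsTri L i j T)
    (hj : j < n) (x : Plane) (hx : ∀ a, i ≤ a → a < j → 0 ≤ orient (q a) (q (a + 1)) x)
    (hneg : orient (q i) (q j) x ≤ 0) (hlt : j = i + 1 → orient (q i) (q j) x < 0) :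
    ∃ t ∈ T, x ∈ tri q t := by
  induction h with
  | side i =>
    have := hx i le_rfl (by omega)
    have := hlt rfl
    linarith
  | @join i m j A B h hA hB ihA ihB =>
    have h1 := hA.lt
    have h2 := hB.lt
    -- The point is beyond one of the two upper sides of the base triangle, and induction applies
    -- there, or it is in the triangle. Being strictly beyond provides `hlt` when that part is a
    -- single side.
    by_cases hi : orient (q i) (q m) x < 0
    · obtain ⟨t, ht, hxt⟩ := ihA (by omega) (fun a ha ha' => hx a ha (by omega)) hi.le (fun _ => hi)
      exact ⟨t, by simp [ht], hxt⟩
    by_cases hi' : orient (q m) (q j) x < 0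
    · obtain ⟨t, ht, hxt⟩ := ihB hj (fun a ha ha' => hx a (by omega) ha') hi'.le (fun _ => hi')
      exact ⟨t, by simp [ht], hxt⟩
    push Not at hi hi'
    refine ⟨(i, m, j), by simp, ?_⟩
    have hD : 0 < orient (q i) (q m) (q j) := S.orient_pos _ _ _ h1 h2 hj
      (S.isTri_legal hA (by omega)).1 (S.isTri_legal hB hj).1 h
    have hswap : orient (q j) (q i) x = -orient (q i) (q j) x := by simp only [orient]; ring
    exact mem_convexHull_of_orient hD hi hi' (by rw [hswap]; linarith)

lemma dissects_of_isTri (S : ChordSystem n q L) {i j : ℕ} {T : Finset (ℕ × ℕ × ℕ)}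
    (h : IsTri L i j T) (hj : j < n) : Dissects q L i j T := by
  refine ⟨(S.isTri_legal h hj).2, S.isTri_disjoint h hj, fun hij x hx => ?_⟩
  have h₁ : ∀ a, i ≤ a → a < j → 0 ≤ orient (q a) (q (a + 1)) x := by
    intro a ha ha'
    refine (convexHull_min (t := {x | 0 ≤ orient (q a) (q (a + 1)) x}) ?_
      (convex_orient_nonneg _ _)) hx
    rintro _ ⟨b, ⟨hb, hb'⟩, rfl⟩
    by_cases hba : b ≤ a
    · exact S.orient_nonneg_before (by omega) hba (by omega)
    · exact S.orient_nonneg_after (by omega) (by omega) (by omega)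
  have h₂ : orient (q i) (q j) x ≤ 0 := by
    refine (convexHull_min (t := {x | orient (q i) (q j) x ≤ 0}) ?_
      (convex_orient_nonpos _ _)) hx
    rintro _ ⟨b, ⟨hb, hb'⟩, rfl⟩
    exact S.orient_nonpos_outer hj hb hb'
  obtain ⟨t, ht, hxt⟩ := S.isTri_cover h hj x h₁ h₂ (by omega)
  simp only [Set.mem_iUnion]
  exact ⟨t, ht, hxt⟩

/-- The right side does not involve the points, so the number of dissections depends on the legality
relation alone. -/
lemma dissects_iff_isTri (S : ChordSystem n q L) {i j : ℕ} (hij : i < j) (hj : j < n) (hL : L i j)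
    {T : Finset (ℕ × ℕ × ℕ)} : Dissects q L i j T ↔ IsTri L i j T :=
  ⟨S.isTri_of_dissects _ i j rfl hij hj hL T, fun h => S.dissects_of_isTri h hj⟩

end ChordSystem

/-! ### Counting triangulations of a chord system -/

/-- The vertex set of a triangle. -/
def vertexSet (q : ℕ → Plane) (t : ℕ × ℕ × ℕ) : Finset Plane :=
  open Classical in {q t.1, q t.2.1, q t.2.2}

lemma coe_vertexSet (q : ℕ → Plane) (t : ℕ × ℕ × ℕ) :
    (vertexSet q t : Set Plane) = {q t.1, q t.2.1, q t.2.2} := by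
  simp [vertexSet]

lemma convexHull_vertexSet (q : ℕ → Plane) (t : ℕ × ℕ × ℕ) :
    convexHull ℝ (vertexSet q t : Set Plane) = tri q t := by
  rw [coe_vertexSet, tri]

lemma collinear_iff_orient {p q s : Plane} : Collinear ℝ {p, q, s} ↔ orient p q s = 0 := by
  constructor
  · intro h
    rw [collinear_iff_of_mem (p₀ := p) (by simp)] at h
    obtain ⟨v, h⟩ := h
    obtain ⟨a, ha⟩ := h q (by simp)
    obtain ⟨b, hb⟩ := h s (by simp)
    rw [ha, hb]
    simp only [orient, vadd_eq_add, PiLp.add_apply, PiLp.smul_apply, smul_eq_mul]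
    ring
  · intro h
    by_cases hpq : q = p
    · subst hpq
      simpa using collinear_pair ℝ q s
    · rw [collinear_iff_of_mem (p₀ := p) (by simp)]
      set D := (q 0 - p 0) ^ 2 + (q 1 - p 1) ^ 2 with hD
      have hD0 : D ≠ 0 := by
        intro h0
        apply hpq
        have h1 : q 0 - p 0 = 0 := by nlinarith [sq_nonneg (q 0 - p 0), sq_nonneg (q 1 - p 1)]
        have h2 : q 1 - p 1 = 0 := by nlinarith [sq_nonneg (q 0 - p 0), sq_nonneg (q 1 - p 1)]
        ext i
        fin_cases i <;> simp <;> linarith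
      refine ⟨q - p, ?_⟩
      rintro x (rfl | rfl | rfl)
      · exact ⟨0, by simp⟩
      · exact ⟨1, by simp⟩
      -- The coefficient of the orthogonal projection of `x - p` to `q - p`, which is exact because
      -- the two are parallel.
      · refine ⟨((x 0 - p 0) * (q 0 - p 0) + (x 1 - p 1) * (q 1 - p 1)) / D, ?_⟩
        simp only [orient] at h
        ext i
        fin_cases i <;> simp <;> field_simp <;> rw [hD]
        · linear_combination (p 1 - q 1) * h
        · linear_combination (q 0 - p 0) * h

/-- Listing the vertices in increasing order makes the triple recoverable from the set. -/
lemma vertexSet_injOn {n : ℕ} {q : ℕ → Plane} (hq : Set.InjOn q (Set.Iio n)) :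
    Set.InjOn (vertexSet q) {t | t.1 < t.2.1 ∧ t.2.1 < t.2.2 ∧ t.2.2 < n} := by
  rintro ⟨a, b, c⟩ ⟨h1, h2, h3⟩ ⟨a', b', c'⟩ ⟨h1', h2', h3'⟩ h
  simp only at h1 h2 h3 h1' h2' h3'
  have hset : q '' {a, b, c} = q '' {a', b', c'} := by
    have := congrArg (fun s : Finset Plane => (s : Set Plane)) h
    simpa only [coe_vertexSet, Set.image_insert_eq, Set.image_singleton] using this
  rw [hq.image_eq_image_iff (by rintro x (rfl | rfl | rfl) <;> simp <;> omega)
    (by rintro x (rfl | rfl | rfl) <;> simp <;> omega)] at hset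
  have e1 : a ∈ ({a', b', c'} : Set ℕ) := hset ▸ (by simp)
  have e2 : b ∈ ({a', b', c'} : Set ℕ) := hset ▸ (by simp)
  have e3 : c ∈ ({a', b', c'} : Set ℕ) := hset ▸ (by simp)
  have e4 : a' ∈ ({a, b, c} : Set ℕ) := hset ▸ (by simp)
  have e5 : c' ∈ ({a, b, c} : Set ℕ) := hset ▸ (by simp)
  simp only [Set.mem_insert_iff, Set.mem_singleton_iff] at e1 e2 e3 e4 e5
  ext <;> simp <;> omega

/-- No further vertex lies in a legal triangle. -/
lemma ChordSystem.tri_inter {n : ℕ} {q : ℕ → Plane} {L : ℕ → ℕ → Prop} (S : ChordSystem n q L)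
    {t : ℕ × ℕ × ℕ} (ht : LegalTriangle L 0 (n - 1) t) (hn : 0 < n) :
    tri q t ∩ q '' Set.Iio n = vertexSet q t := by
  obtain ⟨a, b, c⟩ := t
  have hD := S.orient_pos_of_legal (by omega) ht
  obtain ⟨-, hab, hbc, hcn, hLab, hLbc, hLac⟩ := ht
  simp only at hab hbc hcn hLab hLbc hLac hD
  rw [coe_vertexSet]
  apply Set.Subset.antisymm
  · rintro _ ⟨hx, ⟨d, hd, rfl⟩⟩
    simp only [Set.mem_Iio] at hd
    by_contra hcon
    simp only [Set.mem_insert_iff, Set.mem_singleton_iff, not_or] at hcon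
    have hda : d ≠ a := fun h => hcon.1 (by rw [h])
    have hdb : d ≠ b := fun h => hcon.2.1 (by rw [h])
    have hdc : d ≠ c := fun h => hcon.2.2 (by rw [h])
    have h1 : 0 ≤ orient (q a) (q b) (q d) :=
      tri_orient_nonneg (t := (a, b, c)) (by simp) (by simp) hD.le _ hx
    have h2 : 0 ≤ orient (q b) (q c) (q d) :=
      tri_orient_nonneg (t := (a, b, c)) (by rw [orient_rotate]; exact hD.le) (by simp)
        (by simp) _ hx
    have h3 : 0 ≤ orient (q c) (q a) (q d) :=
      tri_orient_nonneg (t := (a, b, c)) (by simp)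
        (by rw [orient_rotate, orient_rotate]; exact hD.le) (by simp) _ hx
    -- Wherever `d` falls among `a < b < c`, it is strictly outside the side of the triangle that
    -- cuts off its arc.
    rcases lt_or_gt_of_ne hda with hda | hda
    · have := S.orient_pos_right d a c hda (by omega) (by omega) hLac
      have e : orient (q c) (q a) (q d) = - orient (q d) (q a) (q c) := by
        simp only [orient]; ring
      linarith
    rcases lt_or_gt_of_ne hdb with hdb | hdb
    · have := S.orient_pos_mid a d b hda hdb (by omega) (by omega) hLab
      rw [orient_swap] at h1
      linarith
    rcases lt_or_gt_of_ne hdc with hdc | hdc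
    · have := S.orient_pos_mid b d c hdb hdc (by omega) (by omega) hLbc
      rw [orient_swap] at h2
      linarith
    · have := S.orient_pos_left a c d (by omega) hdc (by omega) hLac
      have e : orient (q c) (q a) (q d) = - orient (q a) (q c) (q d) := by
        simp only [orient]; ring
      linarith
  · rintro x hx
    refine ⟨subset_convexHull ℝ _ hx, ?_⟩
    rcases hx with rfl | rfl | rfl
    · exact ⟨a, by simp; omega, rfl⟩
    · exact ⟨b, by simp; omega, rfl⟩
    · exact ⟨c, by simp; omega, rfl⟩

/-- A triangulation all of whose triangles are legal is the same as a combinatorial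
triangulation. -/
lemma ChordSystem.setOf_isTriangulation {n : ℕ} {q : ℕ → Plane} {L : ℕ → ℕ → Prop}
    (S : ChordSystem n q L) (hn : 3 ≤ n) (hL : L 0 (n - 1)) (hq : Set.InjOn q (Set.Iio n)) :
    {T : Finset (Finset Plane) | IsTriangulation (q '' Set.Iio n) T ∧
      ∀ τ ∈ T, ∃ t, LegalTriangle L 0 (n - 1) t ∧ τ = vertexSet q t} =
    (open Classical in fun T : Finset (ℕ × ℕ × ℕ) => T.image (vertexSet q)) ''
      {T | IsTri L 0 (n - 1) T} := by
  classical
  have hIcc : Set.Icc 0 (n - 1) = Set.Iio n := by ext x; simp; omega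
  have hinj := vertexSet_injOn hq
  have hmem : ∀ t, LegalTriangle L 0 (n - 1) t →
      t ∈ {t : ℕ × ℕ × ℕ | t.1 < t.2.1 ∧ t.2.1 < t.2.2 ∧ t.2.2 < n} := by
    intro t ht
    have := ht.right_le
    exact ⟨ht.lt_mid, ht.mid_lt, by omega⟩
  ext T
  simp only [Set.mem_ofPred_eq, Set.mem_image]
  constructor
  · rintro ⟨hT, hleg⟩
    -- `f` picks the index triple of each triangle; on `T` it is a right inverse of `vertexSet q`.
    choose! f hf using hleg
    have hfT : (T.image f).image (vertexSet q) = T := by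
      rw [Finset.image_image]
      conv_rhs => rw [← Finset.image_id (s := T)]
      exact Finset.image_congr fun τ hτ => (hf τ hτ).2.symm
    refine ⟨T.image f, ?_, ?_⟩
    · rw [← S.dissects_iff_isTri (by omega) (by omega) hL]
      refine ⟨?_, ?_, ?_⟩
      · intro t ht
        obtain ⟨τ, hτ, rfl⟩ := Finset.mem_image.mp ht
        exact (hf τ hτ).1
      · intro s hs t ht hne
        obtain ⟨σ, hσ, rfl⟩ := Finset.mem_image.mp hs
        obtain ⟨τ, hτ, rfl⟩ := Finset.mem_image.mp ht
        rw [← convexHull_vertexSet, ← convexHull_vertexSet, ← (hf σ hσ).2, ← (hf τ hτ).2]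
        exact hT.disjoint _ hσ _ hτ (fun h => hne (by rw [h]))
      · intro _
        rw [hIcc, ← hT.cover]
        intro x hx
        simp only [Set.mem_iUnion] at hx ⊢
        obtain ⟨τ, hτ, hx⟩ := hx
        refine ⟨f τ, Finset.mem_image_of_mem _ hτ, ?_⟩
        rw [← convexHull_vertexSet, ← (hf τ hτ).2]
        exact hx
    · convert hfT
  · rintro ⟨T, hT, rfl⟩
    have hD := S.dissects_of_isTri hT (by omega)
    refine ⟨⟨?_, ?_, ?_, ?_, ?_⟩, ?_⟩
    · intro τ hτ
      obtain ⟨t, ht, rfl⟩ := Finset.mem_image.mp hτ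
      obtain ⟨h1, h2, h3⟩ := hmem _ (hD.legal t ht)
      have e1 : q t.1 ≠ q t.2.1 := fun h => by
        have := hq (by simp; omega) (by simp; omega) h
        omega
      have e2 : q t.1 ≠ q t.2.2 := fun h => by
        have := hq (by simp; omega) (by simp; omega) h
        omega
      have e3 : q t.2.1 ≠ q t.2.2 := fun h => by
        have := hq (by simp; omega) (by simp; omega) h
        omega
      rw [vertexSet]
      convert Finset.card_eq_three.mpr ⟨_, _, _, e1, e2, e3, rfl⟩
    · intro τ hτ
      obtain ⟨t, ht, rfl⟩ := Finset.mem_image.mp hτ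
      rw [coe_vertexSet, collinear_iff_orient]
      exact (S.orient_pos_of_legal (by omega) (hD.legal t ht)).ne'
    · intro τ hτ
      obtain ⟨t, ht, rfl⟩ := Finset.mem_image.mp hτ
      rw [convexHull_vertexSet]
      exact S.tri_inter (hD.legal t ht) (by omega)
    · intro σ hσ τ hτ hne
      obtain ⟨s, hs, rfl⟩ := Finset.mem_image.mp hσ
      obtain ⟨t, ht, rfl⟩ := Finset.mem_image.mp hτ
      rw [convexHull_vertexSet, convexHull_vertexSet]
      exact hD.disjoint _ hs _ ht (fun h => hne (by rw [h]))
    · apply Set.Subset.antisymm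
      · refine Set.iUnion₂_subset fun τ hτ => ?_
        obtain ⟨t, ht, rfl⟩ := Finset.mem_image.mp hτ
        obtain ⟨h1, h2, h3⟩ := hmem _ (hD.legal t ht)
        refine convexHull_mono ?_
        rw [coe_vertexSet]
        rintro x (rfl | rfl | rfl)
        · exact ⟨t.1, by simp; omega, rfl⟩
        · exact ⟨t.2.1, by simp; omega, rfl⟩
        · exact ⟨t.2.2, by simp; omega, rfl⟩
      · have hc := hD.cover (by omega)
        rw [hIcc] at hc
        refine hc.trans fun x hx => ?_
        simp only [Set.mem_iUnion] at hx ⊢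
        obtain ⟨t, ht, hx⟩ := hx
        refine ⟨_, Finset.mem_image_of_mem _ ht, ?_⟩
        rwa [convexHull_vertexSet]
    · intro τ hτ
      obtain ⟨t, ht, rfl⟩ := Finset.mem_image.mp hτ
      exact ⟨t, hD.legal t ht, rfl⟩

/-- Legal triangulations of a chord system are counted by the combinatorial triangulations. -/
lemma ChordSystem.ncard_isTriangulation {n : ℕ} {q : ℕ → Plane} {L : ℕ → ℕ → Prop}
    (S : ChordSystem n q L) (hn : 3 ≤ n) (hL : L 0 (n - 1)) (hq : Set.InjOn q (Set.Iio n)) :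
    {T : Finset (Finset Plane) | IsTriangulation (q '' Set.Iio n) T ∧
      ∀ τ ∈ T, ∃ t, LegalTriangle L 0 (n - 1) t ∧ τ = vertexSet q t}.ncard =
    {T | IsTri L 0 (n - 1) T}.ncard := by
  classical
  rw [S.setOf_isTriangulation hn hL hq]
  refine Set.InjOn.ncard_image ?_
  intro A hA B hB h
  have hsub : ∀ T, IsTri L 0 (n - 1) T → (T : Set (ℕ × ℕ × ℕ)) ⊆
      {t : ℕ × ℕ × ℕ | t.1 < t.2.1 ∧ t.2.1 < t.2.2 ∧ t.2.2 < n} := by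
    intro T hT t ht
    have hl := (S.isTri_legal hT (by omega)).2 t ht
    have := hl.right_le
    exact ⟨hl.lt_mid, hl.mid_lt, by omega⟩
  have h' := congrArg (fun s : Finset (Finset Plane) => (s : Set (Finset Plane))) h
  simp only [Finset.coe_image] at h'
  rw [(vertexSet_injOn hq).image_eq_image_iff (hsub A hA) (hsub B hB)] at h'
  exact_mod_cast h'

/-! ### The recurrence for combinatorial triangulations -/

/-- The number of combinatorial triangulations of the polygon with the vertices `i, …, j`. -/
def triCount (L : ℕ → ℕ → Prop) (i j : ℕ) : ℕ := {T | IsTri L i j T}.ncard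

lemma IsTri.bounds {L : ℕ → ℕ → Prop} {i j : ℕ} {T : Finset (ℕ × ℕ × ℕ)} (h : IsTri L i j T) :
    ∀ t ∈ T, i ≤ t.1 ∧ t.1 < t.2.1 ∧ t.2.1 < t.2.2 ∧ t.2.2 ≤ j := by
  induction h with
  | side i => simp
  | join h hA hB ihA ihB =>
    have h1 := hA.lt
    have h2 := hB.lt
    intro t ht
    simp only [Finset.mem_insert, Finset.mem_union] at ht
    rcases ht with rfl | ht | ht
    · exact ⟨le_rfl, h1, h2, le_rfl⟩
    · have := ihA t ht
      omega
    · have := ihB t ht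
      omega

lemma isTri_side_iff {L : ℕ → ℕ → Prop} {i : ℕ} {T : Finset (ℕ × ℕ × ℕ)} :
    IsTri L i (i + 1) T ↔ T = ∅ := by
  constructor
  · intro h
    rw [Finset.eq_empty_iff_forall_notMem]
    intro t ht
    have := h.bounds t ht
    omega
  · rintro rfl
    exact IsTri.side i

lemma triCount_side (L : ℕ → ℕ → Prop) (i : ℕ) : triCount L i (i + 1) = 1 := by
  simp [triCount, isTri_side_iff]

lemma triCount_of_le (L : ℕ → ℕ → Prop) {i j : ℕ} (h : j ≤ i) : triCount L i j = 0 := by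
  have : {T | IsTri L i j T} = ∅ := by
    ext T
    simp only [Set.mem_ofPred_eq, Set.mem_empty_iff_false, iff_false]
    intro hT
    have := hT.lt
    omega
  rw [triCount, this, Set.ncard_empty]

lemma isTri_join_iff {L : ℕ → ℕ → Prop} {i j : ℕ} (hij : i + 2 ≤ j) {T : Finset (ℕ × ℕ × ℕ)} :
    IsTri L i j T ↔ L i j ∧ ∃ m A B, IsTri L i m A ∧ IsTri L m j B ∧
      T = insert (i, m, j) (A ∪ B) := by
  constructor
  · intro h
    cases h with
    | side => omega
    | join h hA hB => exact ⟨h, _, _, _, hA, hB, rfl⟩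
  · rintro ⟨h, m, A, B, hA, hB, rfl⟩
    exact IsTri.join h hA hB

lemma triCount_of_not {L : ℕ → ℕ → Prop} {i j : ℕ} (hij : i + 2 ≤ j) (h : ¬ L i j) :
    triCount L i j = 0 := by
  have : {T | IsTri L i j T} = ∅ := by
    ext T
    simp [isTri_join_iff hij, h]
  rw [triCount, this, Set.ncard_empty]

/-- Together with `filter_right_of_isTri` and `apex_of_isTri`, this shows that the decomposition at
the base triangle is unique, as the product formula `triCount_join` requires. -/
lemma filter_left_of_isTri {L : ℕ → ℕ → Prop} {i m j : ℕ} {A B : Finset (ℕ × ℕ × ℕ)}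
    (hA : IsTri L i m A) (hB : IsTri L m j B) :
    (insert (i, m, j) (A ∪ B)).filter (fun t => t.2.2 ≤ m) = A := by
  have h1 := hA.lt
  have h2 := hB.lt
  ext t
  simp only [Finset.mem_filter, Finset.mem_insert, Finset.mem_union]
  constructor
  · rintro ⟨rfl | h | h, h'⟩
    · simp at h'; omega
    · exact h
    · have := hB.bounds t h; omega
  · intro h
    have := hA.bounds t h
    exact ⟨Or.inr (Or.inl h), by omega⟩

lemma filter_right_of_isTri {L : ℕ → ℕ → Prop} {i m j : ℕ} {A B : Finset (ℕ × ℕ × ℕ)}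
    (hA : IsTri L i m A) (hB : IsTri L m j B) :
    (insert (i, m, j) (A ∪ B)).filter (fun t => m ≤ t.1) = B := by
  have h1 := hA.lt
  have h2 := hB.lt
  ext t
  simp only [Finset.mem_filter, Finset.mem_insert, Finset.mem_union]
  constructor
  · rintro ⟨rfl | h | h, h'⟩
    · simp at h'; omega
    · have := hA.bounds t h; omega
    · exact h
  · intro h
    have := hB.bounds t h
    exact ⟨Or.inr (Or.inr h), by omega⟩

lemma apex_of_isTri {L : ℕ → ℕ → Prop} {i m m' j : ℕ} {A B : Finset (ℕ × ℕ × ℕ)}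
    (hA : IsTri L i m A) (hB : IsTri L m j B) (h : (i, m', j) ∈ insert (i, m, j) (A ∪ B)) :
    m' = m := by
  have h1 := hA.lt
  have h2 := hB.lt
  simp only [Finset.mem_insert, Finset.mem_union] at h
  rcases h with h | h | h
  · simpa using h
  · have := hA.bounds _ h
    simp only at this
    omega
  · have := hB.bounds _ h
    simp only at this
    omega

lemma finite_isTri (L : ℕ → ℕ → Prop) (i j : ℕ) : {T | IsTri L i j T}.Finite := by
  refine ((Finset.range (j + 1) ×ˢ Finset.range (j + 1) ×ˢ
    Finset.range (j + 1)).powerset.finite_toSet).subset fun T hT => ?_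
  simp only [Finset.coe_powerset, Set.mem_preimage, Set.mem_powerset_iff]
  intro t ht
  have := IsTri.bounds hT t ht
  simp only [Finset.coe_product, Finset.coe_range, Set.mem_prod, Set.mem_Iio]
  omega

lemma triCount_join {L : ℕ → ℕ → Prop} {i j : ℕ} (hij : i + 2 ≤ j) (h : L i j) :
    triCount L i j = ∑ m ∈ Finset.Ioo i j, triCount L i m * triCount L m j := by
  classical
  set F : ℕ → Finset (Finset (ℕ × ℕ × ℕ)) := fun m =>
    ((finite_isTri L i m).toFinset ×ˢ (finite_isTri L m j).toFinset).image
      fun p => insert (i, m, j) (p.1 ∪ p.2) with hF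
  have hmemF : ∀ m T, T ∈ F m ↔ ∃ A B, IsTri L i m A ∧ IsTri L m j B ∧
      insert (i, m, j) (A ∪ B) = T := by
    intro m T
    simp [hF, and_assoc]
  have hset : {T | IsTri L i j T} = ((Finset.Ioo i j).biUnion F : Finset _) := by
    ext T
    simp only [Set.mem_ofPred_eq, isTri_join_iff hij, h, true_and, Finset.coe_biUnion,
      Set.mem_iUnion, Finset.mem_coe, hmemF]
    constructor
    · rintro ⟨m, A, B, hA, hB, rfl⟩
      exact ⟨m, Finset.mem_Ioo.mpr ⟨hA.lt, hB.lt⟩, A, B, hA, hB, rfl⟩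
    · rintro ⟨m, -, A, B, hA, hB, rfl⟩
      exact ⟨m, A, B, hA, hB, rfl⟩
  rw [triCount, hset, Set.ncard_coe_finset, Finset.card_biUnion]
  · refine Finset.sum_congr rfl fun m _ => ?_
    rw [hF, Finset.card_image_of_injOn, Finset.card_product, triCount, triCount,
      Set.ncard_eq_toFinset_card _ (finite_isTri L i m),
      Set.ncard_eq_toFinset_card _ (finite_isTri L m j)]
    rintro ⟨A, B⟩ hp ⟨A', B'⟩ hp' hE
    simp only [Finset.coe_product, Set.Finite.coe_toFinset, Set.mem_prod,
      Set.mem_ofPred_eq] at hp hp' hE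
    have e1 := filter_left_of_isTri hp.1 hp.2
    have e2 := filter_right_of_isTri hp.1 hp.2
    rw [hE, filter_left_of_isTri hp'.1 hp'.2] at e1
    rw [hE, filter_right_of_isTri hp'.1 hp'.2] at e2
    rw [e1, e2]
  · intro m _ m' _ hne
    rw [Function.onFun, Finset.disjoint_left]
    intro T hT hT'
    obtain ⟨A, B, hA, hB, rfl⟩ := (hmemF _ _).mp hT
    obtain ⟨A', B', hA', hB', hE⟩ := (hmemF _ _).mp hT'
    exact hne (apex_of_isTri hA' hB' (hE ▸ Finset.mem_insert_self _ _))

/-! ### Solving the recurrence -/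

/-- The recurrence consults only chords between `i` and `j`. This allows ring and chain to be
compared on intervals where their legality agrees. -/
lemma triCount_congr {L L' : ℕ → ℕ → Prop} : ∀ (d i j : ℕ), j - i = d →
    (∀ a b, i ≤ a → a < b → b ≤ j → (L a b ↔ L' a b)) → triCount L i j = triCount L' i j := by
  intro d
  induction d using Nat.strong_induction_on with
  | _ d ih =>
    intro i j hd h
    rcases le_or_gt j i with hij | hij
    · rw [triCount_of_le L hij, triCount_of_le L' hij]
    rcases (show j = i + 1 ∨ i + 2 ≤ j by omega) with rfl | h2
    · rw [triCount_side, triCount_side]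
    by_cases hL : L i j
    · rw [triCount_join h2 hL, triCount_join h2 ((h i j le_rfl hij le_rfl).mp hL)]
      refine Finset.sum_congr rfl fun m hm => ?_
      rw [Finset.mem_Ioo] at hm
      rw [ih (m - i) (by omega) i m rfl fun a b h1 h2 h3 => h a b h1 h2 (by omega),
        ih (j - m) (by omega) m j rfl fun a b h1 h2 h3 => h a b (by omega) h2 h3]
    · rw [triCount_of_not h2 hL,
        triCount_of_not h2 (fun h' => hL ((h i j le_rfl hij le_rfl).mpr h'))]

/-- Two strictly upper triangular solutions of `G = Y + G * G` agree. -/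
lemma Matrix.eq_of_eq_add_mul_self {n : ℕ} {R : Type*} [CommRing R]
    {Y G H : Matrix (Fin n) (Fin n) R}
    (hG : G = Y + G * G) (hH : H = Y + H * H) (hG0 : ∀ i j, j ≤ i → G i j = 0)
    (hH0 : ∀ i j, j ≤ i → H i j = 0) : G = H := by
  -- Only indices `m` strictly between `i` and `j` contribute to the square, so its entries come
  -- from entries closer to the diagonal.
  have key : ∀ d : ℕ, ∀ i j : Fin n, j.val - i.val = d → G i j = H i j := by
    intro d
    induction d using Nat.strong_induction_on with
    | _ d ih =>
      intro i j hd
      rw [hG, hH, Matrix.add_apply, Matrix.add_apply, Matrix.mul_apply, Matrix.mul_apply]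
      congr 1
      refine Finset.sum_congr rfl fun m _ => ?_
      rcases le_or_gt m i with h1 | h1
      · rw [hG0 i m h1, hH0 i m h1, zero_mul, zero_mul]
      rcases le_or_gt j m with h2 | h2
      · rw [hG0 m j h2, hH0 m j h2, mul_zero, mul_zero]
      rw [Fin.lt_def] at h1 h2
      rw [ih (m.val - i.val) (by omega) i m rfl, ih (j.val - m.val) (by omega) m j rfl]
  ext i j
  exact key _ i j rfl

lemma Matrix.pow_apply_eq_zero_of_lt {n : ℕ} {R : Type*} [CommRing R]
    {Y : Matrix (Fin n) (Fin n) R} (hY : ∀ i j, j ≤ i → Y i j = 0) (N : ℕ) (i j : Fin n)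
    (h : j.val < i.val + N) : (Y ^ N) i j = 0 := by
  induction N generalizing j with
  | zero =>
    rw [pow_zero, Matrix.one_apply_ne]
    rintro rfl
    omega
  | succ N ih =>
    rw [pow_succ, Matrix.mul_apply]
    refine Finset.sum_eq_zero fun m _ => ?_
    rcases le_or_gt j m with h2 | h2
    · rw [hY m j h2, mul_zero]
    · rw [Fin.lt_def] at h2
      rw [ih m (by omega), zero_mul]

lemma Matrix.pow_eq_zero_of_strictUpper {n : ℕ} {R : Type*} [CommRing R]
    {Y : Matrix (Fin n) (Fin n) R} (hY : ∀ i j, j ≤ i → Y i j = 0) {N : ℕ} (hN : n ≤ N) :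
    Y ^ N = 0 := by
  ext i j
  exact Matrix.pow_apply_eq_zero_of_lt hY N i j (by omega)

/-- The Catalan generating function of a nilpotent element `y` solves `c = y + c * c`. -/
lemma catalan_sum_eq {R : Type*} [Ring R] {y : R} {n : ℕ} (hy : ∀ N, n ≤ N → y ^ N = 0) :
    ∑ N ∈ Finset.range n, (catalan N : R) * y ^ (N + 1) =
      y + (∑ N ∈ Finset.range n, (catalan N : R) * y ^ (N + 1)) *
        ∑ N ∈ Finset.range n, (catalan N : R) * y ^ (N + 1) := by
  have hterm : ∀ a b : ℕ, ((catalan a : R) * y ^ (a + 1)) * ((catalan b : R) * y ^ (b + 1)) =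
      ((catalan a * catalan b : ℕ) : R) * y ^ (a + b + 2) := by
    intro a b
    have hc : y ^ (a + 1) * (catalan b : R) = (catalan b : R) * y ^ (a + 1) :=
      (Nat.cast_commute _ _).eq.symm
    rw [mul_assoc, ← mul_assoc (y ^ (a + 1)), hc, mul_assoc, ← pow_add, ← mul_assoc, Nat.cast_mul]
    congr 2
    ring
  have hsq : (∑ N ∈ Finset.range n, (catalan N : R) * y ^ (N + 1)) *
      (∑ N ∈ Finset.range n, (catalan N : R) * y ^ (N + 1)) =
      ∑ s ∈ Finset.range n, (catalan (s + 1) : R) * y ^ (s + 2) := by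
    rw [Finset.sum_mul_sum, ← Finset.sum_product']
    -- Terms with index sum at least `n` vanish by nilpotency; the rest form complete antidiagonals,
    -- to which the Catalan convolution applies.
    have h1 : ∑ p ∈ Finset.range n ×ˢ Finset.range n,
        ((catalan p.1 : R) * y ^ (p.1 + 1)) * ((catalan p.2 : R) * y ^ (p.2 + 1)) =
        ∑ p ∈ (Finset.range n ×ˢ Finset.range n).filter (fun p => p.1 + p.2 < n),
        ((catalan p.1 : R) * y ^ (p.1 + 1)) * ((catalan p.2 : R) * y ^ (p.2 + 1)) := by
      symm
      refine Finset.sum_filter_of_ne fun p _ hp => ?_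
      by_contra hlt
      exact hp (by rw [hterm, hy _ (by omega), mul_zero])
    rw [h1, ← Finset.sum_fiberwise_of_maps_to (t := Finset.range n) (g := fun p => p.1 + p.2)
      (by intro p hp; exact Finset.mem_range.mpr (Finset.mem_filter.mp hp).2)]
    refine Finset.sum_congr rfl fun s hs => ?_
    have hs' := Finset.mem_range.mp hs
    have hf : ((Finset.range n ×ˢ Finset.range n).filter (fun p => p.1 + p.2 < n)).filter
        (fun p => p.1 + p.2 = s) = Finset.HasAntidiagonal.antidiagonal s := by
      ext p
      simp only [Finset.mem_filter, Finset.mem_product, Finset.mem_range,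
        Finset.HasAntidiagonal.mem_antidiagonal]
      omega
    rw [hf, catalan_succ', Nat.cast_sum, Finset.sum_mul]
    refine Finset.sum_congr rfl fun p hp => ?_
    rw [hterm, Finset.HasAntidiagonal.mem_antidiagonal.mp hp]
  -- Appending the zero term `N = n` makes room to split off `N = 0`, which is the summand `y`.
  have hext : ∑ N ∈ Finset.range (n + 1), (catalan N : R) * y ^ (N + 1) =
      ∑ N ∈ Finset.range n, (catalan N : R) * y ^ (N + 1) := by
    rw [Finset.sum_range_succ, hy (n + 1) (by omega), mul_zero, add_zero]
  rw [hsq, ← hext, Finset.sum_range_succ']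
  simp only [catalan_zero, Nat.cast_one, zero_add, pow_one, one_mul]
  rw [add_comm]

/-- Legality of the diagonals of a chain of strings of length `r`. -/
def chainLegal (r a b : ℕ) : Prop := b = a + 1 ∨ (a / r + 1) * r < b

/-- Legality of the diagonals of a closed ring of `k` strings of length `r`. -/
def ringLegal (k r a b : ℕ) : Prop :=
  b = a + 1 ∨ (a = 0 ∧ b + 1 = k * r) ∨ ((a / r + 1) * r < b ∧ (a = 0 → b < (k - 1) * r))

/-- The weight of a step from `a` to `b`: a step of length one has weight `1`, and a step that
skips an interior vertex of a string has weight `-1`. -/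
def stepWeight (r a b : ℕ) : ℝ :=
  (if a + 1 = b then 1 else 0) - (if a + 2 = b ∧ ¬ r ∣ a + 1 then 1 else 0)

def stepMatrix (r n : ℕ) : Matrix (Fin n) (Fin n) ℝ := fun a b => stepWeight r a b

lemma stepMatrix_eq_zero (r n : ℕ) (i j : Fin n) (h : j ≤ i) : stepMatrix r n i j = 0 := by
  rw [Fin.le_def] at h
  rw [stepMatrix, stepWeight, if_neg (by omega), if_neg (by omega), sub_zero]

/-- `(a / r + 1) * r` is the first corner strictly after `a`. A chord from `a` other than a side is
legal in the chain when it ends strictly beyond this corner. -/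
lemma le_next_corner {r : ℕ} (hr : 1 ≤ r) (a : ℕ) : a < (a / r + 1) * r := by
  have := Nat.lt_div_mul_add (a := a) (b := r) hr
  rw [add_mul, one_mul]; exact this

lemma next_corner_mono {r a b : ℕ} (h : a ≤ b) : (a / r + 1) * r ≤ (b / r + 1) * r :=
  Nat.mul_le_mul_right _ (Nat.add_le_add_right (Nat.div_le_div_right h) 1)

lemma next_corner_eq_iff {r : ℕ} (hr : 1 ≤ r) (a : ℕ) : (a / r + 1) * r = a + 1 ↔ r ∣ a + 1 := by
  constructor
  · intro h
    exact ⟨a / r + 1, by rw [← h, mul_comm]⟩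
  · rintro ⟨c, hc⟩
    have h1 : a / r + 1 = (a + r) / r := by rw [Nat.add_div_right _ (by omega)]
    have h2 : c = a / r + 1 := by
      rw [h1]
      symm
      have : a + r = r * c + (r - 1) := by omega
      rw [this, Nat.mul_add_div (by omega), Nat.div_eq_of_lt (by omega), add_zero]
    rw [← h2, hc, mul_comm]

/-- The numbers of triangulations of the chain satisfy a quadratic equation. -/
lemma triCount_chain {r : ℕ} (hr : 1 ≤ r) (i j : ℕ) :
    (triCount (chainLegal r) i j : ℝ) = stepWeight r i j +
      ∑ m ∈ Finset.Ioo i j,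
        (triCount (chainLegal r) i m : ℝ) * (triCount (chainLegal r) m j : ℝ) := by
  rcases le_or_gt j i with hij | hij
  · rw [triCount_of_le _ hij, Finset.Ioo_eq_empty (by omega), stepWeight, if_neg (by omega),
      if_neg (by omega)]
    simp
  rcases (show j = i + 1 ∨ i + 2 ≤ j by omega) with rfl | h2
  · have hIoo : Finset.Ioo i (i + 1) = ∅ := by ext; simp
    rw [triCount_side, stepWeight, if_pos rfl, if_neg (by omega), hIoo]
    simp
  have hc := le_next_corner hr i
  have hdiv := next_corner_eq_iff hr i
  by_cases hL : chainLegal r i j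
  · have hst : stepWeight r i j = 0 := by
      rw [stepWeight, if_neg (by omega), if_neg, sub_zero]
      rintro ⟨rfl, hnd⟩
      rcases hL with hL | hL
      · omega
      · exact hnd (hdiv.mp (by omega))
    rw [hst, zero_add, triCount_join h2 hL]
    push_cast
    rfl
  · have hj : j ≤ (i / r + 1) * r := by
      by_contra hcon
      exact hL (Or.inr (by omega))
    rw [triCount_of_not h2 hL]
    -- An illegal chord counts zero, and so does every chord of length at least two below it. The
    -- product sum is therefore zero, except in length two, where it is `1 * 1` and the weight `-1`
    -- cancels it.
    have hzero : ∀ a b, i ≤ a → a + 2 ≤ b → b ≤ j → triCount (chainLegal r) a b = 0 := by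
      intro a b h1 h3 h4
      refine triCount_of_not h3 ?_
      have := next_corner_mono (r := r) h1
      rintro (h | h) <;> omega
    rcases h2.eq_or_lt with rfl | h3
    · have hst : stepWeight r i (i + 2) = -1 := by
        rw [stepWeight, if_neg (by omega), if_pos, zero_sub]
        refine ⟨rfl, fun hd => ?_⟩
        have := hdiv.mpr hd
        omega
      have hIoo : Finset.Ioo i (i + 2) = {i + 1} := by ext; simp; omega
      rw [hst, hIoo, Finset.sum_singleton, triCount_side, triCount_side]
      simp
    · have hst : stepWeight r i j = 0 := by
        rw [stepWeight, if_neg (by omega), if_neg (by omega), sub_zero]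
      rw [hst, Finset.sum_eq_zero]
      · simp
      · intro m hm
        rw [Finset.mem_Ioo] at hm
        rcases (show i + 2 ≤ m ∨ m + 2 ≤ j by omega) with h | h
        · rw [hzero i m le_rfl h (by omega)]; simp
        · rw [hzero m j (by omega) h le_rfl]; simp

def chainMatrix (r n : ℕ) : Matrix (Fin n) (Fin n) ℝ :=
  fun a b => (triCount (chainLegal r) a b : ℝ)

lemma chainMatrix_eq {r : ℕ} (hr : 1 ≤ r) (n : ℕ) :
    chainMatrix r n = stepMatrix r n + chainMatrix r n * chainMatrix r n := by
  ext i j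
  rw [Matrix.add_apply, Matrix.mul_apply]
  simp only [chainMatrix, stepMatrix]
  rw [triCount_chain hr, Fin.sum_univ_eq_sum_range (fun m : ℕ =>
    (triCount (chainLegal r) i m : ℝ) * (triCount (chainLegal r) m j : ℝ)) n]
  congr 1
  refine Finset.sum_subset (fun m hm => ?_) (fun m _ hm => ?_)
  · rw [Finset.mem_Ioo] at hm
    rw [Finset.mem_range]
    omega
  · rw [Finset.mem_Ioo] at hm
    rcases (show m ≤ i ∨ j ≤ m by omega) with h | h
    · rw [triCount_of_le _ h]; simp
    · rw [triCount_of_le _ h]; simp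

/-- The Catalan series in the nilpotent step matrix solves the same quadratic equation, whose
strictly upper triangular solution is unique. -/
lemma chainMatrix_eq_sum {r : ℕ} (hr : 1 ≤ r) (n : ℕ) :
    chainMatrix r n = ∑ N ∈ Finset.range n,
      (catalan N : Matrix (Fin n) (Fin n) ℝ) * stepMatrix r n ^ (N + 1) := by
  have hY := stepMatrix_eq_zero r n
  refine Matrix.eq_of_eq_add_mul_self (chainMatrix_eq hr n)
    (catalan_sum_eq fun N hN => Matrix.pow_eq_zero_of_strictUpper hY hN) ?_ ?_
  · intro i j hij
    simp [chainMatrix, triCount_of_le _ (Fin.le_def.mp hij)]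
  · intro i j hij
    rw [Fin.le_def] at hij
    rw [Matrix.sum_apply]
    refine Finset.sum_eq_zero fun N _ => ?_
    rw [← nsmul_eq_mul, Matrix.smul_apply, Matrix.pow_apply_eq_zero_of_lt hY _ _ _ (by omega),
      smul_zero]

lemma triCount_chain_eq_sum {r : ℕ} (hr : 1 ≤ r) (n : ℕ) (i j : Fin n) :
    (triCount (chainLegal r) i j : ℝ) =
      ∑ N ∈ Finset.range n, (catalan N : ℝ) * (stepMatrix r n ^ (N + 1)) i j := by
  have := congrFun (congrFun (chainMatrix_eq_sum hr n) i) j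
  rw [Matrix.sum_apply] at this
  rw [chainMatrix] at this
  rw [this]
  refine Finset.sum_congr rfl fun N _ => ?_
  rw [← nsmul_eq_mul, Matrix.smul_apply, nsmul_eq_mul]

/-- The generating function of the signed paths along a string of length `s`. -/
def sidePoly (x : ℝ) : ℕ → ℝ
  | 0 => 1
  | 1 => x
  | s + 2 => x * (sidePoly x (s + 1) - sidePoly x s)

/-- The generating function of the signed paths from `0` to `j`. -/
def pathSum (r n : ℕ) (x : ℝ) (j : ℕ) : ℝ :=
  if h : j < n then ∑ N ∈ Finset.range n, x ^ N * (stepMatrix r n ^ N) ⟨0, by omega⟩ ⟨j, h⟩ else 0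

/-- As the `n`-th power vanishes, the exponents may run from `1` to `n`; the exponent `N + 1` is the
one that accompanies `catalan N`. -/
lemma pathSum_eq (r n : ℕ) (x : ℝ) {j : ℕ} (hj : j < n) :
    pathSum r n x j = (if j = 0 then 1 else 0) + ∑ N ∈ Finset.range n,
      x ^ (N + 1) * (stepMatrix r n ^ (N + 1)) ⟨0, by omega⟩ ⟨j, hj⟩ := by
  have hz : stepMatrix r n ^ n = 0 :=
    Matrix.pow_eq_zero_of_strictUpper (stepMatrix_eq_zero r n) le_rfl
  have hext := Finset.sum_range_succ
    (fun N => x ^ N * (stepMatrix r n ^ N) ⟨0, by omega⟩ ⟨j, hj⟩) n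
  rw [hz, Matrix.zero_apply, mul_zero, add_zero, Finset.sum_range_succ'] at hext
  rw [pathSum, dif_pos hj, ← hext, add_comm]
  congr 1
  simp [Matrix.one_apply, eq_comm]

/-- Splits a path at its last step. -/
lemma pathSum_rec (r n : ℕ) (x : ℝ) {j : ℕ} (hj : j < n) :
    pathSum r n x j = (if j = 0 then 1 else 0) +
      x * ∑ m ∈ Finset.range n, pathSum r n x m * stepWeight r m j := by
  rw [pathSum_eq r n x hj]
  congr 1
  rw [← Fin.sum_univ_eq_sum_range (fun m => pathSum r n x m * stepWeight r m j) n]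
  simp only [pathSum, Fin.is_lt, dif_pos, Finset.sum_mul]
  rw [Finset.sum_comm, Finset.mul_sum]
  refine Finset.sum_congr rfl fun N _ => ?_
  rw [pow_succ (stepMatrix r n), Matrix.mul_apply, pow_succ' x, mul_assoc, Finset.mul_sum]
  congr 1
  refine Finset.sum_congr rfl fun m _ => ?_
  rw [stepMatrix, mul_assoc]

lemma pathSum_zero (r n : ℕ) (x : ℝ) (hn : 0 < n) : pathSum r n x 0 = 1 := by
  rw [pathSum_rec r n x hn, Finset.sum_eq_zero]
  · simp
  · intro m _
    simp [stepWeight]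

lemma pathSum_one (r n : ℕ) (x : ℝ) (hn : 1 < n) : pathSum r n x 1 = x := by
  rw [pathSum_rec r n x hn, Finset.sum_eq_single 0]
  · simp [stepWeight, pathSum_zero r n x (by omega)]
  · intro m _ hm
    simp [stepWeight, hm]
  · simp; omega

lemma pathSum_add_two (r n : ℕ) (x : ℝ) {j : ℕ} (hj : j + 2 < n) :
    pathSum r n x (j + 2) = x * (pathSum r n x (j + 1) -
      if r ∣ j + 1 then 0 else pathSum r n x j) := by
  rw [pathSum_rec r n x hj]
  have h1 : ∑ m ∈ Finset.range n, pathSum r n x m * stepWeight r m (j + 2) =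
      ∑ m ∈ Finset.range n, (if m = j + 1 then pathSum r n x m else 0) -
      ∑ m ∈ Finset.range n, (if m = j then (if r ∣ j + 1 then 0 else pathSum r n x j) else 0) := by
    rw [← Finset.sum_sub_distrib]
    refine Finset.sum_congr rfl fun m _ => ?_
    rw [stepWeight, mul_sub]
    congr 1
    · by_cases h : m = j + 1
      · simp [h]
      · rw [if_neg (by omega), if_neg h, mul_zero]
    · by_cases h : m = j
      · subst h
        by_cases hd : r ∣ m + 1 <;> simp [hd]
      · rw [if_neg (by omega), if_neg h, mul_zero]
  rw [h1, Finset.sum_ite_eq', Finset.sum_ite_eq', if_neg (Nat.succ_ne_zero _), zero_add,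
    if_pos (Finset.mem_range.mpr (by omega)), if_pos (Finset.mem_range.mpr (by omega))]

/-- No step jumps over a corner, so every path visits each corner on its way and the generating
function factors. Allowing `s = r` treats a corner as the end of one string as well as the start of
the next. -/
lemma pathSum_eq_sidePoly {r n : ℕ} (x : ℝ) (i : ℕ) : ∀ s ≤ r, i * r + s < n →
    pathSum r n x (i * r + s) = sidePoly x r ^ i * sidePoly x s := by
  induction i with
  | zero =>
    intro s
    induction s using Nat.strong_induction_on with
    | _ s ih =>
      intro hs hn
      match s with
      | 0 => simpa [sidePoly] using pathSum_zero r n x (by omega)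
      | 1 => simpa [sidePoly] using pathSum_one r n x (by omega)
      | s + 2 =>
        have h1 := ih (s + 1) (by omega) (by omega) (by omega)
        have h2 := ih s (by omega) (by omega) (by omega)
        simp only [zero_mul, zero_add, pow_zero, one_mul] at h1 h2 hn ⊢
        rw [pathSum_add_two r n x hn, h1, h2, if_neg, sidePoly]
        intro hd
        have := Nat.le_of_dvd (by omega) hd
        omega
  | succ i ihi =>
    intro s
    induction s using Nat.strong_induction_on with
    | _ s ih =>
      intro hs hn
      match s with
      | 0 =>
        have h1 := ihi r le_rfl (by rw [add_mul, one_mul] at hn; omega)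
        rw [add_zero, add_mul, one_mul, h1, pow_succ, sidePoly, mul_one]
      | 1 =>
        -- Just past a corner the recurrence loses its negative term, which matches the restart
        -- `sidePoly x 1 = x`.
        have h1 := ih 0 (by omega) (by omega) (by omega)
        obtain ⟨j, hj⟩ : ∃ j, (i + 1) * r = j + 1 := ⟨(i + 1) * r - 1, by
          have : 1 ≤ (i + 1) * r := Nat.mul_pos (by omega) hs
          omega⟩
        rw [add_zero, sidePoly, mul_one] at h1
        have hd : r ∣ j + 1 := hj ▸ Dvd.intro_left _ rfl
        rw [hj] at hn h1 ⊢
        rw [pathSum_add_two r n x hn, h1, if_pos hd, sidePoly, sub_zero, mul_comm]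
      | s + 2 =>
        have h1 := ih (s + 1) (by omega) (by omega) (by omega)
        have h2 := ih s (by omega) (by omega) (by omega)
        rw [← add_assoc] at h1 hn ⊢
        rw [pathSum_add_two r n x hn, h1, h2, if_neg, sidePoly]
        · ring
        · rw [add_assoc, Nat.dvd_add_right (Dvd.intro_left _ rfl)]
          intro hd
          have := Nat.le_of_dvd (by omega) hd
          omega

/-- The legal triangulations of a ring of strings in terms of those of a chain. -/
lemma triCount_ring {k r : ℕ} (hk : 2 ≤ k) (hr : 1 ≤ r) (h3 : 3 ≤ k * r) :
    (triCount (ringLegal k r) 0 (k * r - 1) : ℝ) = triCount (chainLegal r) 0 (k * r - 1) -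
      if 2 ≤ r then (triCount (chainLegal r) 0 (k * r - 2) : ℝ) else 0 := by
  obtain ⟨k, rfl⟩ : ∃ l, k = l + 1 := ⟨k - 1, by omega⟩
  have hkr : (k + 1) * r = k * r + r := by ring
  have hkr2 : 2 ≤ k * r := by
    rcases hr.eq_or_lt with rfl | hr
    · omega
    · nlinarith
  set n := (k + 1) * r with hn
  have hring : ∀ a b, a ≠ 0 → (ringLegal (k + 1) r a b ↔ chainLegal r a b) := by
    intro a b ha
    simp [ringLegal, chainLegal, ha]
  have hrow : ∀ m j, 0 < m → triCount (ringLegal (k + 1) r) m j = triCount (chainLegal r) m j := by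
    intro m j hm
    exact triCount_congr _ m j rfl fun a b h _ _ => hring a b (by omega)
  have hrow0 : ∀ j, j < k * r →
      triCount (ringLegal (k + 1) r) 0 j = triCount (chainLegal r) 0 j := by
    intro j hj
    refine triCount_congr _ 0 j rfl fun a b _ _ hb => ?_
    rcases Nat.eq_zero_or_pos a with rfl | ha
    · simp only [ringLegal, chainLegal, true_and, forall_const, Nat.add_sub_cancel]
      constructor
      · rintro (h | h | h)
        · exact Or.inl h
        · omega
        · exact Or.inr h.1
      · rintro (h | h)
        · exact Or.inl h
        · exact Or.inr (Or.inr ⟨h, by omega⟩)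
    · exact hring a b (by omega)
  have hrow0' : ∀ m, k * r ≤ m → m < n - 1 → triCount (ringLegal (k + 1) r) 0 m = 0 := by
    intro m h1 h2
    refine triCount_of_not (by omega) ?_
    rintro (h | h | h)
    · omega
    · omega
    · have := h.2 rfl
      rw [Nat.add_sub_cancel] at this
      omega
  have hlast : ∀ m, k * r ≤ m → m + 2 ≤ n - 1 → triCount (chainLegal r) m (n - 1) = 0 := by
    intro m h1 h2
    refine triCount_of_not h2 ?_
    have hm : k ≤ m / r := (Nat.le_div_iff_mul_le (by omega)).mpr h1
    have : (k + 1) * r ≤ (m / r + 1) * r := Nat.mul_le_mul_right _ (by omega)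
    rintro (h | h) <;> omega
  -- A step of length two here means `n = 3`, hence `r = 1`, and then every vertex is a corner.
  have hst : stepWeight r 0 (n - 1) = 0 := by
    rw [stepWeight, if_neg (by omega), if_neg, sub_zero]
    rintro ⟨h, hd⟩
    apply hd
    have : r = 1 := by
      by_contra hne
      have : k * r ≤ 1 := by omega
      omega
    simp [this]
  have hL : ringLegal (k + 1) r 0 (n - 1) := Or.inr (Or.inl ⟨rfl, by omega⟩)
  rw [triCount_join (by omega) hL, triCount_chain hr 0 (n - 1), hst, zero_add]
  push_cast
  -- In the ring, `0` also ends the last string, so its chords to vertices `m` of that string, other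
  -- than the closing side, become illegal. In the chain such an `m` contributes only if `m` to `n -
  -- 1` is a side; thus just `m = n - 2` is lost, and only when `2 ≤ r`.
  have hsplit : ∀ m ∈ Finset.Ioo 0 (n - 1),
      (triCount (ringLegal (k + 1) r) 0 m : ℝ) * (triCount (ringLegal (k + 1) r) m (n - 1) : ℝ) =
      (triCount (chainLegal r) 0 m : ℝ) * (triCount (chainLegal r) m (n - 1) : ℝ) -
      if m = n - 2 then (if 2 ≤ r then (triCount (chainLegal r) 0 (n - 2) : ℝ) else 0) else 0 := by
    intro m hm
    rw [Finset.mem_Ioo] at hm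
    rw [hrow m _ hm.1]
    rcases lt_or_ge m (k * r) with h | h
    · rw [hrow0 m h]
      split_ifs <;> first | omega | simp
    · rw [hrow0' m h hm.2]
      by_cases hmn : m = n - 2
      · have e : n - 1 = n - 2 + 1 := by omega
        rw [if_pos hmn, if_pos (by omega), hmn, e, triCount_side]
        simp
      · rw [if_neg hmn, hlast m h (by omega)]
        simp
  rw [Finset.sum_congr rfl hsplit, Finset.sum_sub_distrib, Finset.sum_ite_eq', if_pos]
  rw [Finset.mem_Ioo]
  omega

/-- The legal triangulations of a ring of strings are counted by an umbral evaluation of a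
polynomial: `x ^ N` is replaced by the `N`-th Catalan number in `sidePoly x r ^ k / x ^ 2`. -/
lemma exists_catalan_expansion {k r : ℕ} (hk : 2 ≤ k) (hr : 1 ≤ r) (h3 : 3 ≤ k * r) :
    ∃ (M : ℕ) (e : ℕ → ℝ),
      (∀ x : ℝ, x ^ 2 * ∑ N ∈ Finset.range M, e N * x ^ N = sidePoly x r ^ k) ∧
      (triCount (ringLegal k r) 0 (k * r - 1) : ℝ) =
        ∑ N ∈ Finset.range M, e N * (catalan N : ℝ) := by
  obtain ⟨k, rfl⟩ : ∃ l, k = l + 1 := ⟨k - 1, by omega⟩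
  have hkr : (k + 1) * r = k * r + r := by ring
  set n := (k + 1) * r with hn
  set e : ℕ → ℝ := fun N => (stepMatrix r n ^ (N + 1)) ⟨0, by omega⟩ ⟨n - 1, by omega⟩ -
    if 2 ≤ r then (stepMatrix r n ^ (N + 1)) ⟨0, by omega⟩ ⟨n - 2, by omega⟩ else 0 with he
  refine ⟨n, e, ?_, ?_⟩
  · intro x
    have h1 : pathSum r n x (n - 1) = sidePoly x r ^ k * sidePoly x (r - 1) := by
      rw [← pathSum_eq_sidePoly (n := n) x k (r - 1) (by omega) (by omega)]
      congr 1
      omega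
    rw [pathSum_eq r n x (by omega), if_neg (by omega), zero_add] at h1
    have hsum : x * ∑ N ∈ Finset.range n, e N * x ^ N = sidePoly x r ^ k *
        (sidePoly x (r - 1) - if 2 ≤ r then sidePoly x (r - 2) else 0) := by
      by_cases h2 : 2 ≤ r
      · have h4 : pathSum r n x (n - 2) = sidePoly x r ^ k * sidePoly x (r - 2) := by
          rw [← pathSum_eq_sidePoly (n := n) x k (r - 2) (by omega) (by omega)]
          congr 1
          omega
        have : r ≤ k * r := Nat.le_mul_of_pos_left _ (by omega)
        rw [pathSum_eq r n x (by omega), if_neg (by omega), zero_add] at h4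
        rw [if_pos h2, mul_sub, ← h1, ← h4, ← Finset.sum_sub_distrib, Finset.mul_sum]
        refine Finset.sum_congr rfl fun N _ => ?_
        simp only [he, if_pos h2]
        ring
      · rw [if_neg h2, sub_zero, ← h1, Finset.mul_sum]
        refine Finset.sum_congr rfl fun N _ => ?_
        simp only [he, if_neg h2]
        ring
    -- The two entries subtracted in the ring formula combine by the recurrence of `sidePoly` into
    -- the missing last factor.
    have hfin : x * (sidePoly x (r - 1) - if 2 ≤ r then sidePoly x (r - 2) else 0) =
        sidePoly x r := by
      match r, hr with
      | 1, _ => simp [sidePoly]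
      | r + 2, _ => simp [sidePoly]
    rw [pow_two, mul_assoc, hsum, pow_succ, ← hfin]
    ring
  · rw [triCount_ring hk hr h3]
    have h1 := triCount_chain_eq_sum hr n ⟨0, by omega⟩ ⟨n - 1, by omega⟩
    have h2 := triCount_chain_eq_sum hr n ⟨0, by omega⟩ ⟨n - 2, by omega⟩
    simp only at h1 h2
    rw [h1, h2]
    by_cases hr2 : 2 ≤ r
    · rw [if_pos hr2, ← Finset.sum_sub_distrib]
      refine Finset.sum_congr rfl fun N _ => ?_
      simp only [he, if_pos hr2]
      ring
    · rw [if_neg hr2, sub_zero]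
      refine Finset.sum_congr rfl fun N _ => ?_
      simp only [he, if_neg hr2]
      ring

/-! ### The integral -/

open MeasureTheory Filter Topology

/-- The density of the Catalan moments. -/
def catalanKernel (N : ℕ) (u : ℝ) : ℝ := u ^ 2 / (1 + 4 * u ^ 2) ^ (N + 2)

lemma one_add_pos (u : ℝ) : 0 < 1 + 4 * u ^ 2 := by positivity

lemma continuous_catalanKernel (N : ℕ) : Continuous (catalanKernel N) := by
  unfold catalanKernel
  exact (by fun_prop : Continuous fun u : ℝ => u ^ 2).div (by fun_prop)
    fun u => pow_ne_zero _ (one_add_pos u).ne'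

lemma integrable_catalanKernel (N : ℕ) : Integrable (catalanKernel N) := by
  have h : Integrable (fun u : ℝ => (1 + u ^ 2)⁻¹) := integrable_inv_one_add_sq
  refine h.mono' (continuous_catalanKernel N).aestronglyMeasurable (ae_of_all _ fun u => ?_)
  have h1 := one_add_pos u
  have h2 : (1 : ℝ) ≤ 1 + 4 * u ^ 2 := by nlinarith [sq_nonneg u]
  rw [catalanKernel, Real.norm_of_nonneg (by positivity), ← one_div,
    div_le_div_iff₀ (by positivity) (by positivity), one_mul]
  calc u ^ 2 * (1 + u ^ 2) ≤ (1 + 4 * u ^ 2) ^ 2 := by nlinarith [sq_nonneg u, sq_nonneg (u ^ 2)]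
    _ ≤ (1 + 4 * u ^ 2) ^ (N + 2) := pow_le_pow_right₀ h2 (by omega)

lemma integral_catalanKernel_zero : ∫ u, catalanKernel 0 u = Real.pi / 16 := by
  have hderiv : ∀ u : ℝ, HasDerivAt
      (fun u : ℝ => -(u / (8 * (1 + 4 * u ^ 2))) + 1 / 16 * Real.arctan (2 * u))
      (catalanKernel 0 u) u := by
    intro u
    have h1 := (one_add_pos u).ne'
    have h0 : HasDerivAt (fun u : ℝ => 8 * (1 + 4 * u ^ 2)) (64 * u) u := by
      have := (((hasDerivAt_pow 2 u).const_mul 4).const_add 1).const_mul 8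
      exact this.congr_deriv (by norm_num; ring)
    have h2 := ((hasDerivAt_id u).div h0 (by positivity)).neg
    have h3 := (((hasDerivAt_id u).const_mul 2).arctan).const_mul (1 / 16)
    refine (h2.add h3).congr_deriv ?_
    simp only [catalanKernel, id]
    have h4 : (1 + (2 * u) ^ 2 : ℝ) ≠ 0 := by positivity
    field_simp
    ring
  have hsmall : Tendsto (fun u : ℝ => u / (8 * (1 + 4 * u ^ 2))) (cocompact ℝ) (𝓝 0) := by
    refine squeeze_zero_norm' (a := fun u : ℝ => ‖u‖⁻¹) ?_
      (tendsto_inv_atTop_zero.comp (tendsto_norm_cocompact_atTop (E := ℝ)))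
    refine Eventually.of_forall fun u => ?_
    rcases eq_or_ne u 0 with rfl | hu
    · simp
    · have h1 := one_add_pos u
      rw [norm_div, Real.norm_of_nonneg (by positivity : 0 ≤ 8 * (1 + 4 * u ^ 2)), inv_eq_one_div,
        div_le_div_iff₀ (by positivity) (norm_pos_iff.mpr hu), one_mul, Real.norm_eq_abs,
        abs_mul_abs_self]
      nlinarith [sq_nonneg u]
  have htop : Tendsto (fun u : ℝ => -(u / (8 * (1 + 4 * u ^ 2))) + 1 / 16 * Real.arctan (2 * u))
      atTop (𝓝 (-0 + 1 / 16 * (Real.pi / 2))) := by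
    refine ((hsmall.mono_left atTop_le_cocompact).neg).add (Tendsto.const_mul _ ?_)
    exact (Real.tendsto_arctan_atTop.mono_right nhdsWithin_le_nhds).comp
      (tendsto_id.const_mul_atTop (by norm_num))
  have hbot : Tendsto (fun u : ℝ => -(u / (8 * (1 + 4 * u ^ 2))) + 1 / 16 * Real.arctan (2 * u))
      atBot (𝓝 (-0 + 1 / 16 * (-(Real.pi / 2)))) := by
    refine ((hsmall.mono_left atBot_le_cocompact).neg).add (Tendsto.const_mul _ ?_)
    exact (Real.tendsto_arctan_atBot.mono_right nhdsWithin_le_nhds).comp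
      (tendsto_id.const_mul_atBot (by norm_num))
  rw [integral_of_hasDerivAt_of_tendsto hderiv (integrable_catalanKernel 0) hbot htop]
  ring

/-- The difference of the two sides is the integral of the derivative of u³/(1+4u²)^(N+2), which
vanishes at both ends. After scaling by powers of 4 this is the Catalan recurrence
`catalan_succ_real`. -/
lemma integral_catalanKernel_succ (N : ℕ) :
    2 * (N + 2) * ∫ u, catalanKernel (N + 1) u = (2 * N + 1) * ∫ u, catalanKernel N u := by
  have hderiv : ∀ u : ℝ, HasDerivAt (fun u : ℝ => u ^ 3 / (1 + 4 * u ^ 2) ^ (N + 2))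
      (2 * (N + 2) * catalanKernel (N + 1) u - (2 * N + 1) * catalanKernel N u) u := by
    intro u
    have h1 := (one_add_pos u).ne'
    have h0 : HasDerivAt (fun u : ℝ => 1 + 4 * u ^ 2) (8 * u) u := by
      have := ((hasDerivAt_pow 2 u).const_mul 4).const_add 1
      exact this.congr_deriv (by norm_num; ring)
    have h2 := (hasDerivAt_pow 3 u).div (h0.pow (N + 2)) (pow_ne_zero _ h1)
    refine h2.congr_deriv ?_
    simp only [catalanKernel, Pi.pow_apply]
    push_cast
    field_simp
    ring
  have hint : Integrable fun u : ℝ =>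
      2 * ((N : ℝ) + 2) * catalanKernel (N + 1) u - (2 * N + 1) * catalanKernel N u :=
    ((integrable_catalanKernel _).const_mul _).sub ((integrable_catalanKernel _).const_mul _)
  have hlim : Tendsto (fun u : ℝ => u ^ 3 / (1 + 4 * u ^ 2) ^ (N + 2)) (cocompact ℝ) (𝓝 0) := by
    refine squeeze_zero_norm' (a := fun u : ℝ => ‖u‖⁻¹) ?_
      (tendsto_inv_atTop_zero.comp (tendsto_norm_cocompact_atTop (E := ℝ)))
    refine Eventually.of_forall fun u => ?_
    rcases eq_or_ne u 0 with rfl | hu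
    · simp
    · have h1 := one_add_pos u
      have h2 : (1 : ℝ) ≤ 1 + 4 * u ^ 2 := by nlinarith [sq_nonneg u]
      rw [norm_div, norm_pow, Real.norm_of_nonneg (by positivity : 0 ≤ (1 + 4 * u ^ 2) ^ (N + 2)),
        inv_eq_one_div, div_le_div_iff₀ (by positivity) (norm_pos_iff.mpr hu), one_mul,
        Real.norm_eq_abs, ← pow_succ]
      calc |u| ^ (3 + 1) = u ^ 4 := by
            rw [show 3 + 1 = 2 * 2 by norm_num, pow_mul, sq_abs]; ring
        _ ≤ (1 + 4 * u ^ 2) ^ 2 := by nlinarith [sq_nonneg u, sq_nonneg (u ^ 2)]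
        _ ≤ (1 + 4 * u ^ 2) ^ (N + 2) := pow_le_pow_right₀ h2 (by omega)
  have := integral_of_hasDerivAt_of_tendsto hderiv hint (hlim.mono_left atBot_le_cocompact)
    (hlim.mono_left atTop_le_cocompact)
  rw [integral_sub ((integrable_catalanKernel _).const_mul _)
    ((integrable_catalanKernel _).const_mul _), integral_const_mul, integral_const_mul,
    sub_self] at this
  linarith

lemma catalan_succ_real (N : ℕ) :
    ((N : ℝ) + 2) * (catalan (N + 1) : ℝ) = 2 * (2 * N + 1) * (catalan N : ℝ) := by
  have h1 : ((N + 1 + 1 : ℕ) : ℝ) * (catalan (N + 1) : ℝ) = (Nat.centralBinom (N + 1) : ℝ) := by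
    exact_mod_cast succ_mul_catalan_eq_centralBinom (N + 1)
  have h2 : ((N + 1 : ℕ) : ℝ) * (catalan N : ℝ) = (Nat.centralBinom N : ℝ) := by
    exact_mod_cast succ_mul_catalan_eq_centralBinom N
  have h3 : ((N + 1 : ℕ) : ℝ) * (Nat.centralBinom (N + 1) : ℝ) =
      2 * (2 * N + 1) * (Nat.centralBinom N : ℝ) := by
    exact_mod_cast Nat.succ_mul_centralBinom_succ N
  rw [← h1, ← h2] at h3
  push_cast at h3
  have h4 : (N : ℝ) + 1 ≠ 0 := by positivity
  apply mul_left_cancel₀ h4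
  linear_combination h3

/-- The Catalan numbers as moments. -/
lemma integral_catalanKernel (N : ℕ) :
    4 ^ N * ∫ u, catalanKernel N u = Real.pi / 16 * (catalan N : ℝ) := by
  induction N with
  | zero => rw [integral_catalanKernel_zero]; simp
  | succ N ih =>
    have h1 := integral_catalanKernel_succ N
    have h2 := catalan_succ_real N
    have h4 : (N : ℝ) + 2 ≠ 0 := by positivity
    apply mul_left_cancel₀ h4
    rw [pow_succ]
    linear_combination 2 * 4 ^ N * h1 + 2 * (2 * N + 1) * ih - Real.pi / 16 * h2

/-- The side polynomial as a quotient, in terms of the roots `a`, `b` of `t ^ 2 - x t + x`. -/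
lemma sidePoly_mul_sub {x : ℝ} {a b : ℂ} (hs : a + b = x) (hp : a * b = x) (s : ℕ) :
    (sidePoly x s : ℂ) * (a - b) = a ^ (s + 1) - b ^ (s + 1) := by
  induction s using Nat.strong_induction_on with
  | _ s ih =>
    match s with
    | 0 => simp [sidePoly]
    | 1 => simp only [sidePoly, ← hs]; ring
    | s + 2 =>
      have h1 := ih (s + 1) (by omega)
      have h2 := ih s (by omega)
      rw [sidePoly, Complex.ofReal_mul, Complex.ofReal_sub]
      have e : (x : ℂ) * (sidePoly x (s + 1) - sidePoly x s) * (a - b) =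
          x * ((sidePoly x (s + 1) : ℂ) * (a - b)) - x * ((sidePoly x s : ℂ) * (a - b)) := by ring
      rw [e, h1, h2]
      nth_rewrite 1 [← hs]
      rw [← hp]
      ring

/-- The integrand in terms of the side polynomials. -/
lemma saddleIntegrand_eq {k r : ℕ} {u : ℝ} (hu : u ≠ 0) :
    saddleIntegrand k r u * (2 : ℂ) ^ (((r : ℤ) - 2) * (k : ℤ)) = -((u : ℂ) ^ 2 *
      (sidePoly (4 / (1 + 4 * u ^ 2)) r : ℂ) ^ k) := by
  set x : ℝ := 4 / (1 + 4 * u ^ 2) with hx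
  set z : ℂ := 1 + 2 * Complex.I * u with hz
  set w : ℂ := 1 - 2 * Complex.I * u with hw
  have hzw : z * w = 1 + 4 * (u : ℂ) ^ 2 := by
    rw [hz, hw]; linear_combination (-4 * (u : ℂ) ^ 2) * Complex.I_sq
  have hS : (1 + 4 * (u : ℂ) ^ 2) ≠ 0 := by
    have := (one_add_pos u).ne'
    exact_mod_cast this
  have hz0 : z ≠ 0 := fun h => hS (by rw [← hzw, h, zero_mul])
  have hw0 : w ≠ 0 := fun h => hS (by rw [← hzw, h, mul_zero])
  have hxc : (x : ℂ) = 4 / (z * w) := by rw [hx, hzw]; push_cast; rfl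
  have hsum : z + w = 2 := by rw [hz, hw]; ring
  -- The roots are `2 / w` and `2 / z`; their sum equals their product because `z + w = 2`.
  have h1 : 2 / w + 2 / z = (x : ℂ) := by
    rw [hxc]; field_simp; rw [hsum]; ring
  have h2 : 2 / w * (2 / z) = (x : ℂ) := by
    rw [hxc]; field_simp; ring
  have hside := sidePoly_mul_sub h1 h2 r
  have hu' : (u : ℂ) ≠ 0 := by exact_mod_cast hu
  have hiu : Complex.I * (u : ℂ) ≠ 0 := mul_ne_zero Complex.I_ne_zero hu'
  have hdiff : z - w = 4 * (Complex.I * u) := by rw [hz, hw]; ring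
  have hE : z ^ (r + 1) - w ^ (r + 1) =
      (sidePoly x r : ℂ) * (4 * (Complex.I * u)) * (z * w) ^ r / 2 ^ r := by
    have e1 : (2 / w - 2 / z) * (z * w) = 2 * (z - w) := by field_simp
    have e2 : ((2 / w) ^ (r + 1) - (2 / z) ^ (r + 1)) * (z * w) ^ (r + 1) =
        2 ^ (r + 1) * (z ^ (r + 1) - w ^ (r + 1)) := by
      rw [div_pow, div_pow, mul_pow]; field_simp
    rw [← hside] at e2
    rw [← hdiff]
    rw [eq_div_iff (pow_ne_zero _ two_ne_zero)]
    have e3 : (2 : ℂ) * ((z ^ (r + 1) - w ^ (r + 1)) * 2 ^ r) =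
        2 * ((sidePoly x r : ℂ) * (z - w) * (z * w) ^ r) := by
      calc (2 : ℂ) * ((z ^ (r + 1) - w ^ (r + 1)) * 2 ^ r)
          = 2 ^ (r + 1) * (z ^ (r + 1) - w ^ (r + 1)) := by ring
        _ = (sidePoly x r : ℂ) * ((2 / w - 2 / z) * (z * w)) * (z * w) ^ r := by rw [← e2]; ring
        _ = _ := by rw [e1]; ring
    exact mul_left_cancel₀ two_ne_zero e3
  rw [saddleIntegrand, ← hz, ← hw, hE, ← hzw, zpow_sub₀ hiu, zpow_natCast, zpow_mul,
    zpow_sub₀ two_ne_zero, zpow_natCast, zpow_natCast]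
  have hzw0 : z * w ≠ 0 := mul_ne_zero hz0 hw0
  set v := Complex.I * (u : ℂ) with hv
  have hv2 : (u : ℂ) ^ 2 = -v ^ 2 := by rw [hv, mul_pow, Complex.I_sq]; ring
  rw [hv2]
  set p := (sidePoly x r : ℂ)
  set t := z * w
  rw [div_pow, div_pow, mul_pow, mul_pow, mul_pow, ← pow_mul t]
  have h22 : ((2 : ℂ) ^ (2 : ℤ)) = 4 := by norm_num
  have hv2' : v ^ (2 : ℤ) = v ^ 2 := by norm_cast
  rw [h22, hv2']
  have h4 : (4 : ℂ) ^ k ≠ 0 := pow_ne_zero _ (by norm_num)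
  have h2r : ((2 : ℂ) ^ r) ^ k ≠ 0 := pow_ne_zero _ (pow_ne_zero _ two_ne_zero)
  field_simp

/-- The value of the integral when `sidePoly x r ^ k / x ^ 2` is a polynomial. -/
lemma integral_saddle {k r M : ℕ} {e : ℕ → ℝ}
    (he : ∀ x : ℝ, x ≠ 0 → x ^ 2 * ∑ N ∈ Finset.range M, e N * x ^ N = sidePoly x r ^ k) :
    Integrable (saddleIntegrand k r) ∧
    (((∑ N ∈ Finset.range M, e N * (catalan N : ℝ) : ℝ)) : ℂ) =
      -((2 : ℂ) ^ (((r : ℤ) - 2) * (k : ℤ)) / (Real.pi : ℂ)) * ∫ u : ℝ, saddleIntegrand k r u := by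
  set c : ℂ := (2 : ℂ) ^ (((r : ℤ) - 2) * (k : ℤ)) with hc
  have hc0 : c ≠ 0 := zpow_ne_zero _ two_ne_zero
  set F : ℝ → ℝ := fun u => ∑ N ∈ Finset.range M, e N * 4 ^ N * catalanKernel N u with hF
  have hFint : Integrable F :=
    integrable_finsetSum _ fun N _ => (integrable_catalanKernel N).const_mul _
  have hFval : ∫ u, F u = Real.pi / 16 * ∑ N ∈ Finset.range M, e N * (catalan N : ℝ) := by
    rw [hF, integral_finsetSum _ fun N _ => (integrable_catalanKernel N).const_mul _,
      Finset.mul_sum]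
    refine Finset.sum_congr rfl fun N _ => ?_
    rw [integral_const_mul, mul_assoc, integral_catalanKernel]
    ring
  have hpt : ∀ u : ℝ, u ≠ 0 → saddleIntegrand k r u = -16 / c * (F u : ℂ) := by
    intro u hu
    have h := saddleIntegrand_eq (k := k) (r := r) hu
    have h1 := one_add_pos u
    rw [← hc] at h
    -- For x = 4/(1+4u²), the monomial u² x^(N+2) is 16 · 4^N times `catalanKernel N u`.
    have hp : u ^ 2 * sidePoly (4 / (1 + 4 * u ^ 2)) r ^ k = 16 * F u := by
      rw [← he _ (by positivity), hF, Finset.mul_sum, Finset.mul_sum, Finset.mul_sum]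
      refine Finset.sum_congr rfl fun N _ => ?_
      rw [catalanKernel, div_pow, div_pow]
      field_simp
      ring
    have hp' : (u : ℂ) ^ 2 * (sidePoly (4 / (1 + 4 * u ^ 2)) r : ℂ) ^ k = 16 * (F u : ℂ) := by
      exact_mod_cast hp
    rw [hp'] at h
    field_simp
    linear_combination h
  have hae : saddleIntegrand k r =ᵐ[volume] fun u => -16 / c * (F u : ℂ) := by
    have : ∀ᵐ u : ℝ, u ≠ 0 := by
      rw [ae_iff]
      simp
    filter_upwards [this] with u hu using hpt u hu
  refine ⟨(hFint.ofReal.const_mul _).congr hae.symm, ?_⟩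
  rw [integral_congr_ae hae, integral_const_mul, integral_complex_ofReal, hFval]
  have hpi : (Real.pi : ℂ) ≠ 0 := by exact_mod_cast Real.pi_ne_zero
  push_cast
  field_simp

/-- The explicit form of the side polynomial. -/
lemma sidePoly_eq_sum (x : ℝ) (s : ℕ) :
    sidePoly x s = ∑ m ∈ Finset.range (s + 1),
      (-1 : ℝ) ^ m * ((s - m).choose m : ℝ) * x ^ (s - m) := by
  induction s using Nat.strong_induction_on with
  | _ s ih =>
    match s with
    | 0 => simp [sidePoly]
    | 1 => simp [sidePoly, Finset.sum_range_succ]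
    | s + 2 =>
      rw [sidePoly, ih (s + 1) (by omega), ih s (by omega), mul_sub,
        Finset.sum_range_succ' _ (s + 1), Finset.sum_range_succ' _ (s + 2),
        Finset.sum_range_succ _ (s + 1), mul_add, Finset.mul_sum, Finset.mul_sum]
      have h0 : ((s + 2 - (s + 1 + 1)).choose (s + 1 + 1) : ℝ) = 0 := by simp
      rw [h0]
      simp only [pow_zero, Nat.sub_zero, Nat.choose_zero_right]
      rw [add_sub_right_comm, ← Finset.sum_sub_distrib]
      simp only [mul_zero, zero_mul, add_zero, one_mul, Nat.cast_one, ← pow_succ']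
      congr 1
      refine Finset.sum_congr rfl fun m hm => ?_
      have hm' := Finset.mem_range.mp hm
      -- Pascal's rule is the coefficient form of the recurrence.
      rw [show s + 1 - (m + 1) = s - m by omega, show s + 2 - (m + 1) = s - m + 1 by omega,
        Nat.choose_succ_succ]
      push_cast
      ring

/-- The sum is the evaluation of `sidePoly x r / x ^ 2` term by term. For `3 ≤ r` and `m ≤ r / 2`
the exponent `r - m` is at least 2, so `r - m - 2` is not truncated. -/
lemma single_string_expansion {r : ℕ} (hr : 3 ≤ r) :
    ∃ (M : ℕ) (e : ℕ → ℝ),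
      (∀ x : ℝ, x ≠ 0 → x ^ 2 * ∑ N ∈ Finset.range M, e N * x ^ N = sidePoly x r ^ 1) ∧
      (∑ m ∈ Finset.range (r / 2 + 1),
          (-1 : ℝ) ^ m * ((r - m).choose m : ℝ) * (catalan (r - m - 2) : ℝ)) =
        ∑ N ∈ Finset.range M, e N * (catalan N : ℝ) := by
  have htrunc : ∀ f : ℕ → ℝ, ∑ m ∈ Finset.range (r + 1), (-1 : ℝ) ^ m * ((r - m).choose m : ℝ) * f m
      = ∑ m ∈ Finset.range (r / 2 + 1), (-1 : ℝ) ^ m * ((r - m).choose m : ℝ) * f m := by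
    intro f
    symm
    refine Finset.sum_subset (Finset.range_mono (by omega)) fun m _ hm => ?_
    rw [Finset.mem_range] at hm
    rw [Nat.choose_eq_zero_of_lt (by omega)]
    simp
  have hreindex : ∀ f : ℕ → ℝ, ∑ N ∈ Finset.range (r - 1),
      (∑ m ∈ Finset.range (r / 2 + 1), if r - m - 2 = N then
        (-1 : ℝ) ^ m * ((r - m).choose m : ℝ) else 0) * f N =
      ∑ m ∈ Finset.range (r / 2 + 1), (-1 : ℝ) ^ m * ((r - m).choose m : ℝ) * f (r - m - 2) := by
    intro f
    simp only [Finset.sum_mul]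
    rw [Finset.sum_comm]
    refine Finset.sum_congr rfl fun m _ => ?_
    simp only [ite_mul, zero_mul]
    rw [Finset.sum_ite_eq, if_pos (Finset.mem_range.mpr (by omega))]
  refine ⟨r - 1, fun N => ∑ m ∈ Finset.range (r / 2 + 1), if r - m - 2 = N then
        (-1 : ℝ) ^ m * ((r - m).choose m : ℝ) else 0, fun x _ => ?_, ?_⟩
  · rw [hreindex, pow_one, sidePoly_eq_sum, htrunc, Finset.mul_sum]
    refine Finset.sum_congr rfl fun m hm => ?_
    rw [Finset.mem_range] at hm
    obtain ⟨t, ht⟩ : ∃ t, r - m = t + 2 := ⟨r - m - 2, by omega⟩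
    rw [ht, Nat.add_sub_cancel]
    ring
  · rw [hreindex]

/-! ### Rings of strings in the plane -/

lemma orient_combo_fst (p q x y : Plane) {a b : ℝ} (h : a + b = 1) :
    orient (a • x + b • y) p q = a * orient x p q + b * orient y p q := by
  obtain rfl : b = 1 - a := by linarith
  simp only [orient, PiLp.add_apply, PiLp.smul_apply, smul_eq_mul]; ring

lemma orient_combo_snd (p q x y : Plane) {a b : ℝ} (h : a + b = 1) :
    orient p (a • x + b • y) q = a * orient p x q + b * orient p y q := by
  obtain rfl : b = 1 - a := by linarith
  simp only [orient, PiLp.add_apply, PiLp.smul_apply, smul_eq_mul]; ring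

lemma orient_lineMap_pair (x y p : Plane) (s t : ℝ) :
    orient (AffineMap.lineMap x y s) (AffineMap.lineMap x y t) p = (t - s) * orient x y p := by
  simp only [orient, AffineMap.lineMap_apply_module, PiLp.add_apply, PiLp.smul_apply, smul_eq_mul]
  ring

lemma lineMap_mem_segment_lineMap (x y : Plane) {s t u : ℝ} (h₁ : s < t) (h₂ : t < u) :
    AffineMap.lineMap x y t ∈ segment ℝ (AffineMap.lineMap x y s : Plane)
      (AffineMap.lineMap x y u) := by
  have h : u - s ≠ 0 := by linarith
  refine ⟨(u - t) / (u - s), (t - s) / (u - s), div_nonneg (by linarith) (by linarith),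
    div_nonneg (by linarith) (by linarith), ?_, ?_⟩
  · field_simp; ring
  · ext i
    simp only [AffineMap.lineMap_apply_module, PiLp.add_apply, PiLp.smul_apply, smul_eq_mul]
    field_simp
    ring

/-- Points `q 0, …, q (k r - 1)` that subdivide the sides of a convex polygon with the corners
`A 0, …, A (k - 1), A k = A 0`. -/
structure StringRing (k r : ℕ) (A : ℕ → Plane) (s : ℕ → ℝ) (q : ℕ → Plane) : Prop where
  corner : ∀ a b c, a < b → b < c → c < k → 0 < orient (A a) (A b) (A c)
  closed : A k = A 0
  nonneg : ∀ t, t < k * r → 0 ≤ s t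
  lt_one : ∀ t, t < k * r → s t < 1
  pos : ∀ t, t < k * r → ¬ r ∣ t → 0 < s t
  eq_zero : ∀ t, t < k * r → r ∣ t → s t = 0
  mono : ∀ t t', t < t' → t' < k * r → t / r = t' / r → s t < s t'
  eq : ∀ t, t < k * r → q t = AffineMap.lineMap (A (t / r)) (A (t / r + 1)) (s t)

/-! ### Positions of the points on a subdivided polygon -/

namespace StringRing

variable {k r : ℕ} {A : ℕ → Plane} {s : ℕ → ℝ} {q : ℕ → Plane}

lemma corner_pos (R : StringRing k r A s q) {a b c : ℕ} (hab : a < b) (hbc : b < c) (hc : c ≤ k)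
    (h : a ≠ 0 ∨ c ≠ k) : 0 < orient (A a) (A b) (A c) := by
  rcases hc.eq_or_lt with rfl | hc
  · rw [R.closed, orient_rotate]
    exact R.corner _ _ _ (by omega) hab (by omega)
  · exact R.corner _ _ _ hab hbc hc

lemma corner_nonneg (R : StringRing k r A s q) {a b c : ℕ} (hab : a ≤ b) (hbc : b ≤ c)
    (hc : c ≤ k) : 0 ≤ orient (A a) (A b) (A c) := by
  rcases hab.eq_or_lt with rfl | hab
  · simp
  rcases hbc.eq_or_lt with rfl | hbc
  · simp
  by_cases h : a ≠ 0 ∨ c ≠ k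
  · exact (R.corner_pos hab hbc hc h).le
  · push Not at h
    obtain ⟨rfl, rfl⟩ := h
    rw [R.closed]
    simp

lemma div_lt (_R : StringRing k r A s q) {t : ℕ} (ht : t < k * r) : t / r < k :=
  Nat.div_lt_of_lt_mul (by rwa [mul_comm])

/-- The area is affine in each point, so it expands into nonnegative areas of corner triples. The
extra conditions exclude three points on one side, including the last side, which ends at the point
`0`; then some term is positive. -/
lemma orient_sign (R : StringRing k r A s q) (hk : 3 ≤ k) (hr : 1 ≤ r) {a b c : ℕ} (hab : a < b)
    (hbc : b < c) (hc : c < k * r) :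
    0 ≤ orient (q a) (q b) (q c) ∧ ((a / r + 1) * r < c → (a = 0 → b < (k - 1) * r) →
      0 < orient (q a) (q b) (q c)) := by
  have hb : b < k * r := by omega
  have ha : a < k * r := by omega
  have ia := R.div_lt ha
  have ib := R.div_lt hb
  have ic := R.div_lt hc
  have iab : a / r ≤ b / r := Nat.div_le_div_right hab.le
  have ibc : b / r ≤ c / r := Nat.div_le_div_right hbc.le
  have sa0 := R.nonneg a ha
  have sb0 := R.nonneg b hb
  have sc0 := R.nonneg c hc
  have sa1 : 0 < 1 - s a := by linarith [R.lt_one a ha]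
  have sb1 : 0 < 1 - s b := by linarith [R.lt_one b hb]
  have sc1 : 0 < 1 - s c := by linarith [R.lt_one c hc]
  rcases iab.eq_or_lt with iab | iab
  · rw [R.eq a ha, R.eq b hb, ← iab, orient_lineMap_pair]
    have hst := R.mono a b hab hb iab
    have hst' : 0 < s b - s a := by linarith
    rw [← iab] at ibc
    rcases ibc.eq_or_lt with ibc | ibc
    · rw [R.eq c hc, ← ibc]
      have hz : orient (A (a / r)) (A (a / r + 1))
          (AffineMap.lineMap (A (a / r)) (A (a / r + 1)) (s c)) = 0 := by
        rw [AffineMap.lineMap_apply_module, orient_combo₂ _ _ _ _ (by ring)]; simp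
      rw [hz, mul_zero]
      refine ⟨le_rfl, fun h => ?_⟩
      have := le_next_corner hr c
      rw [← ibc] at this
      omega
    · rw [R.eq c hc, AffineMap.lineMap_apply_module, orient_combo₂ _ _ _ _ (by ring)]
      have n1 := R.corner_nonneg (a := a / r) (b := a / r + 1) (c := c / r) (by omega) (by omega)
        (by omega)
      have n2 := R.corner_nonneg (a := a / r) (b := a / r + 1) (c := c / r + 1) (by omega)
        (by omega) (by omega)
      -- Makes the weight an atom, so that `positivity` finds its sign among the hypotheses.
      generalize 1 - s c = w at *
      refine ⟨mul_nonneg hst'.le (by positivity), fun h _ => mul_pos hst' ?_⟩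
      rcases (show a / r + 1 < c / r ∨ c / r = a / r + 1 by omega) with hlt | heq
      · have p1 := R.corner_pos (a := a / r) (b := a / r + 1) (c := c / r) (by omega) hlt
          (by omega) (by omega)
        positivity
      · have p2 := R.corner_pos (a := a / r) (b := a / r + 1) (c := c / r + 1) (by omega)
          (by omega) (by omega) (by omega)
        have hsc : 0 < s c := by
          refine R.pos c hc fun hd => ?_
          have := Nat.div_mul_cancel hd
          rw [heq] at this
          omega
        positivity
  · rcases ibc.eq_or_lt with ibc | ibc
    · rw [R.eq b hb, R.eq c hc, ← ibc, ← orient_rotate, orient_lineMap_pair]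
      have hst := R.mono b c hbc hc ibc
      have hst' : 0 < s c - s b := by linarith
      rw [R.eq a ha, AffineMap.lineMap_apply_module, orient_combo₂ _ _ _ _ (by ring),
        orient_rotate (A (a / r)), orient_rotate (A (a / r + 1))]
      have n1 := R.corner_nonneg (a := a / r) (b := b / r) (c := b / r + 1) (by omega) (by omega)
        (by omega)
      have n2 := R.corner_nonneg (a := a / r + 1) (b := b / r) (c := b / r + 1) (by omega)
        (by omega) (by omega)
      generalize 1 - s a = w at *
      refine ⟨mul_nonneg hst'.le (by positivity), fun _ h => mul_pos hst' ?_⟩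
      by_cases h0 : a / r ≠ 0 ∨ b / r + 1 ≠ k
      · have p1 := R.corner_pos (a := a / r) (b := b / r) (c := b / r + 1) (by omega) (by omega)
          (by omega) h0
        positivity
      · push Not at h0
        have p2 := R.corner_pos (a := a / r + 1) (b := b / r) (c := b / r + 1) (by omega) (by omega)
          (by omega) (by omega)
        have hsa : 0 < s a := by
          refine R.pos a ha fun hd => ?_
          have h1 := Nat.div_mul_cancel hd
          rw [h0.1, zero_mul] at h1
          have h2 := h h1.symm
          have h3 := Nat.div_lt_of_lt_mul (by rwa [mul_comm] at h2)
          omega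
        positivity
    · have key : 0 < orient (q a) (q b) (q c) := by
        rw [R.eq a ha, R.eq b hb, R.eq c hc]
        simp only [AffineMap.lineMap_apply_module]
        have wa : 1 - s a + s a = 1 := by ring
        have wb : 1 - s b + s b = 1 := by ring
        have wc : 1 - s c + s c = 1 := by ring
        simp only [orient_combo_fst _ _ _ _ wa, orient_combo_snd _ _ _ _ wb,
          orient_combo₂ _ _ _ _ wc]
        have p := R.corner_pos (a := a / r) (b := b / r) (c := c / r) iab ibc ic.le (by omega)
        have n2 := R.corner_nonneg (a := a / r) (b := b / r) (c := c / r + 1) (by omega) (by omega)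
          (by omega)
        have n3 := R.corner_nonneg (a := a / r) (b := b / r + 1) (c := c / r) (by omega) (by omega)
          (by omega)
        have n4 := R.corner_nonneg (a := a / r) (b := b / r + 1) (c := c / r + 1) (by omega)
          (by omega) (by omega)
        have n5 := R.corner_nonneg (a := a / r + 1) (b := b / r) (c := c / r) (by omega) (by omega)
          (by omega)
        have n6 := R.corner_nonneg (a := a / r + 1) (b := b / r) (c := c / r + 1) (by omega)
          (by omega) (by omega)
        have n7 := R.corner_nonneg (a := a / r + 1) (b := b / r + 1) (c := c / r) (by omega)
          (by omega) (by omega)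
        have n8 := R.corner_nonneg (a := a / r + 1) (b := b / r + 1) (c := c / r + 1) (by omega)
          (by omega) (by omega)
        generalize 1 - s a = x at *
        generalize 1 - s b = y at *
        generalize 1 - s c = z at *
        positivity
      exact ⟨key.le, fun _ _ => key⟩

lemma two_mul_le (hk : 3 ≤ k) : 2 * r ≤ (k - 1) * r := Nat.mul_le_mul_right _ (by omega)

lemma mul_eq_add (hk : 1 ≤ k) : k * r = (k - 1) * r + r := by
  obtain ⟨l, rfl⟩ : ∃ l, k = l + 1 := ⟨k - 1, by omega⟩
  rw [Nat.add_sub_cancel]; ring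

lemma chordSystem (R : StringRing k r A s q) (hk : 3 ≤ k) (hr : 1 ≤ r) :
    ChordSystem (k * r) q (ringLegal k r) := by
  have h2 := two_mul_le (r := r) hk
  have hn := mul_eq_add (k := k) (r := r) (by omega)
  have hpos : ∀ a b c, a < b → b < c → c < k * r → (a / r + 1) * r < c →
      (a = 0 → b < (k - 1) * r) → 0 < orient (q a) (q b) (q c) := fun a b c h1 h2 h3 =>
    (R.orient_sign hk hr h1 h2 h3).2
  -- From a vertex of the last string no corner below `k * r` lies ahead, so its only legal chord to
  -- a later vertex is a side.
  have hlast : ∀ b, (k - 1) * r ≤ b → k * r ≤ (b / r + 1) * r := by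
    intro b hb
    have : k - 1 ≤ b / r := (Nat.le_div_iff_mul_le (by omega)).mpr hb
    exact Nat.mul_le_mul_right _ (by omega)
  constructor
  · exact fun a _ => Or.inl rfl
  · exact fun a b c h1 h2 h3 => (R.orient_sign hk hr h1 h2 h3).1
  · rintro a b c h1 h3 h4 (h | h | h)
    · omega
    · omega
    · exact hpos a b c (by omega) h3 h4 (by omega) h.2
  · rintro a b c h1 h3 h4 (h | h | h)
    · omega
    · omega
    · have := next_corner_mono (r := r) h1.le
      refine hpos a b c h1 (by omega) h4 (by omega) fun _ => ?_
      by_contra hcon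
      have := hlast b (by omega)
      omega
  · rintro a b c h1 h3 h4 h5 (h | h | h)
    · omega
    · omega
    · exact hpos a b c h1 h3 h4 h.1 fun h0 => by have := h.2 h0; omega
  · rintro b h1 h3 (h | h | h)
    · refine hpos 0 b _ h1 (by omega) (by omega) ?_ fun _ => by omega
      simp; omega
    · omega
    · refine hpos 0 b _ h1 (by omega) (by omega) ?_ h.2
      have := h.1
      omega
  · intro a b c h1 h3 h4 hab hbc hac
    have hb : a = 0 → b < (k - 1) * r := by
      intro h0
      rcases hab with h | h | h
      · omega
      · omega
      · exact h.2 h0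
    refine hpos a b c h1 h3 h4 ?_ hb
    rcases hac with h | h | h
    · omega
    · obtain ⟨rfl, h⟩ := h
      simp; omega
    · exact h.1

lemma injOn (R : StringRing k r A s q) (hk : 3 ≤ k) (hr : 1 ≤ r) :
    Set.InjOn q (Set.Iio (k * r)) := by
  have h2 := two_mul_le (r := r) hk
  have hn := mul_eq_add (k := k) (r := r) (by omega)
  have key : ∀ a b, a < b → b < k * r → q a ≠ q b := by
    intro a b hab hb heq
    have hpos : ∀ a b c, a < b → b < c → c < k * r → (a / r + 1) * r < c →
        (a = 0 → b < (k - 1) * r) → 0 < orient (q a) (q b) (q c) := fun a b c h1 h2 h3 =>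
      (R.orient_sign hk hr h1 h2 h3).2
    have hc := le_next_corner hr a
    -- Coinciding points have zero area with any third point. A third point in general position is
    -- `a + 1`, the second corner after `a`, `0` or `r`, depending on the position of the pair.
    rcases lt_or_ge ((a / r + 1) * r) b with h | h
    · have := hpos a (a + 1) b (by omega) (by omega) hb h (by omega)
      rw [heq, orient_self_left] at this
      exact lt_irrefl _ this
    rcases (show a / r + 2 ≤ k - 1 ∨ k - 1 ≤ a / r + 1 by omega) with h3 | h3
    · have h4 : (a / r + 2) * r ≤ (k - 1) * r := Nat.mul_le_mul_right _ h3
      have h5 : (a / r + 2) * r = (a / r + 1) * r + r := by ring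
      have := hpos a b ((a / r + 2) * r) hab (by omega) (by omega) (by omega) (by omega)
      rw [heq, orient_same] at this
      exact lt_irrefl _ this
    rcases lt_or_ge a ((k - 1) * r) with h4 | h4
    · have h5 : 1 * r ≤ (a / r) * r := Nat.mul_le_mul_right _ (by omega)
      have h6 := Nat.div_mul_le_self a r
      have := hpos 0 a b (by omega) hab hb (by simp; omega) (by omega)
      rw [heq, orient_self_right] at this
      exact lt_irrefl _ this
    · have h7 : (r / r + 1) * r = 2 * r := by rw [Nat.div_self (by omega)]
      by_cases h8 : a = r
      · omega
      · have := hpos r a b (by omega) hab hb (by omega) (by omega)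
        rw [heq, orient_self_right] at this
        exact lt_irrefl _ this
  intro a ha b hb h
  rcases lt_trichotomy a b with h' | h' | h'
  · exact absurd h (key a b h' hb)
  · exact h'
  · exact absurd h.symm (key b a h' ha)

/-- An illegal diagonal passes through a further point. -/
lemma exists_mem_segment (R : StringRing k r A s q) (hk : 3 ≤ k) (hr : 1 ≤ r) {a b : ℕ}
    (hab : a < b) (hb : b < k * r) (hL : ¬ ringLegal k r a b) :
    ∃ d < k * r, d ≠ a ∧ d ≠ b ∧ q d ∈ segment ℝ (q a) (q b) := by
  have hn := mul_eq_add (k := k) (r := r) (by omega)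
  have h2 := two_mul_le (r := r) hk
  simp only [ringLegal, not_or, not_and, not_forall] at hL
  obtain ⟨h1, h3, h4⟩ := hL
  have hc := le_next_corner hr a
  rcases lt_or_ge ((a / r + 1) * r) b with h | h
  · obtain ⟨rfl, h5⟩ := h4 h
    have h6 : b / r = k - 1 := by
      apply Nat.div_eq_of_lt_le
      · omega
      · rw [Nat.sub_add_cancel (by omega)]; omega
    have h7 : (k * r - 1) / r = k - 1 := by
      apply Nat.div_eq_of_lt_le
      · omega
      · rw [Nat.sub_add_cancel (by omega)]; omega
    have hlt : b < k * r - 1 := by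
      have := h3 rfl
      omega
    refine ⟨k * r - 1, by omega, by omega, by omega, ?_⟩
    -- The point `0` is read as the end of the last side, with parameter 1.
    have e0 : q 0 = AffineMap.lineMap (A (k - 1)) (A (k - 1 + 1)) (1 : ℝ) := by
      rw [R.eq 0 (by omega), R.eq_zero 0 (by omega) (dvd_zero r), Nat.sub_add_cancel (by omega),
        R.closed]
      simp
    rw [e0, R.eq b hb, R.eq (k * r - 1) (by omega), h6, h7, segment_symm]
    exact lineMap_mem_segment_lineMap _ _ (R.mono _ _ hlt (by omega) (by rw [h6, h7]))
      (R.lt_one _ (by omega))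
  · have h5 : (a + 1) / r = a / r := by
      apply Nat.div_eq_of_lt_le
      · have := Nat.div_mul_le_self a r
        omega
      · omega
    refine ⟨a + 1, by omega, by omega, by omega, ?_⟩
    have hm := R.mono a (a + 1) (by omega) (by omega) h5.symm
    rcases h.eq_or_lt with h | h
    · have e : q b = AffineMap.lineMap (A (a / r)) (A (a / r + 1)) (1 : ℝ) := by
        have hd : b / r = a / r + 1 := by rw [h, Nat.mul_div_cancel _ (by omega)]
        rw [R.eq b hb, R.eq_zero b hb ⟨a / r + 1, by rw [h, mul_comm]⟩, hd]
        simp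
      rw [e, R.eq a (by omega), R.eq (a + 1) (by omega), h5]
      exact lineMap_mem_segment_lineMap _ _ hm (R.lt_one _ (by omega))
    · have h6 : b / r = a / r := by
        apply Nat.div_eq_of_lt_le
        · have := Nat.div_mul_le_self a r
          omega
        · omega
      rw [R.eq a (by omega), R.eq b hb, R.eq (a + 1) (by omega), h5, h6]
      exact lineMap_mem_segment_lineMap _ _ hm (R.mono _ _ (by omega) hb (h5.trans h6.symm))

end StringRing

/-! ### Triangulations of a subdivided polygon -/

lemma exists_vertexSet_eq {n : ℕ} {q : ℕ → Plane} {τ : Finset Plane} (hτ : τ.card = 3)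
    (hsub : (τ : Set Plane) ⊆ q '' Set.Iio n) :
    ∃ t : ℕ × ℕ × ℕ, t.1 < t.2.1 ∧ t.2.1 < t.2.2 ∧ t.2.2 < n ∧ τ = vertexSet q t := by
  classical
  obtain ⟨x, y, z, hxy, hxz, hyz, rfl⟩ := Finset.card_eq_three.mp hτ
  obtain ⟨a, ha, rfl⟩ := hsub (by simp : x ∈ _)
  obtain ⟨b, hb, rfl⟩ := hsub (by simp : y ∈ _)
  obtain ⟨c, hc, rfl⟩ := hsub (by simp : z ∈ _)
  have hab : a ≠ b := fun h => hxy (by rw [h])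
  have hac : a ≠ c := fun h => hxz (by rw [h])
  have hbc : b ≠ c := fun h => hyz (by rw [h])
  simp only [Set.mem_Iio] at ha hb hc
  rcases lt_or_gt_of_ne hab with h1 | h1 <;> rcases lt_or_gt_of_ne hac with h2 | h2 <;>
    rcases lt_or_gt_of_ne hbc with h3 | h3
  · exact ⟨(a, b, c), h1, h3, hc, by ext; simp [vertexSet]⟩
  · exact ⟨(a, c, b), h2, h3, hb, by ext; simp [vertexSet]; tauto⟩
  · omega
  · exact ⟨(c, a, b), h2, h1, hb, by ext; simp [vertexSet]; tauto⟩
  · exact ⟨(b, a, c), h1, h2, hc, by ext; simp [vertexSet]; tauto⟩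
  · omega
  · exact ⟨(b, c, a), h3, h2, ha, by ext; simp [vertexSet]; tauto⟩
  · exact ⟨(c, b, a), h3, h1, ha, by ext; simp [vertexSet]; tauto⟩

lemma ringLegal_root {k r : ℕ} (h : 1 ≤ k * r) : ringLegal k r 0 (k * r - 1) :=
  Or.inr (Or.inl ⟨rfl, by omega⟩)

/-- Legality is automatic: an illegal side would contain a further point of the set. By `inter_eq`
that point is the third vertex, and the triangle would be collinear. -/
lemma StringRing.numTriangulations_eq {k r : ℕ} {A : ℕ → Plane} {s : ℕ → ℝ} {q : ℕ → Plane}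
    (R : StringRing k r A s q) (hk : 3 ≤ k) (hr : 1 ≤ r) :
    numTriangulations (q '' Set.Iio (k * r)) = triCount (ringLegal k r) 0 (k * r - 1) := by
  have h2 := StringRing.two_mul_le (r := r) hk
  have hn := StringRing.mul_eq_add (k := k) (r := r) (by omega)
  have S := R.chordSystem hk hr
  rw [triCount, ← S.ncard_isTriangulation (by omega) (ringLegal_root (by omega)) (R.injOn hk hr),
    numTriangulations]
  congr 1
  ext T
  simp only [Set.mem_ofPred_eq]
  refine ⟨fun hT => ⟨hT, fun τ hτ => ?_⟩, fun hT => hT.1⟩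
  have hinter := hT.inter_eq τ hτ
  obtain ⟨⟨a, b, c⟩, hab, hbc, hc, rfl⟩ := exists_vertexSet_eq (hT.card_eq τ hτ)
    (hinter ▸ Set.inter_subset_right)
  have hcol := hT.not_collinear _ hτ
  rw [coe_vertexSet] at hcol hinter
  simp only at hab hbc hc hcol hinter
  have key : ∀ d e f : ℕ, ({q d, q e, q f} : Set Plane) = {q a, q b, q c} → d < e → e < k * r →
      ringLegal k r d e := by
    intro d e f hset hde he
    by_contra hL
    obtain ⟨m, hm, hmd, hme, hseg⟩ := R.exists_mem_segment hk hr hde he hL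
    rw [← hset] at hcol hinter
    have hmem : q m ∈ ({q d, q e, q f} : Set Plane) := by
      rw [← hinter]
      refine ⟨?_, m, hm, rfl⟩
      rw [← convexHull_pair] at hseg
      exact convexHull_mono (by intro x; simp; tauto) hseg
    have hinj := R.injOn hk hr
    have hmf : q m = q f := by
      rcases hmem with h | h | h
      · exact absurd (hinj hm (show d < k * r by omega) h) hmd
      · exact absurd (hinj hm he h) hme
      · exact h
    apply hcol
    rw [← hmf, collinear_iff_orient]
    obtain ⟨x, y, -, -, hxy, hxyq⟩ := hseg
    rw [← hxyq, orient_combo₂ _ _ _ _ hxy]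
    simp
  refine ⟨(a, b, c), ⟨Nat.zero_le _, hab, hbc, by simp only; omega, ?_, ?_, ?_⟩, rfl⟩
  · exact key a b c rfl hab (by omega)
  · exact key b c a (by ext; simp; tauto) hbc hc
  · exact key a c b (by ext; simp; tauto) (by omega) hc

/-- The point `i * r + j` is the `j`-th one on side `i`. The end `j = r` of a side is stored as the
start of the next one, cyclically. -/
lemma SubdividedPolygon.exists_stringRing {k r : ℕ} (hk : 3 ≤ k) (hr : 1 ≤ r)
    (P : SubdividedPolygon k r) :
    ∃ A s q, StringRing k r A s q ∧ P.points = q '' Set.Iio (k * r) := by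
  obtain ⟨k, rfl⟩ : ∃ l, k = l + 1 := ⟨k - 1, by omega⟩
  have hdiv : ∀ t, t < (k + 1) * r → t / r % (k + 1) = t / r := fun t ht =>
    Nat.mod_eq_of_lt (Nat.div_lt_of_lt_mul (by rwa [mul_comm]))
  have hmod : ∀ t, t % r < r + 1 := fun t => (Nat.mod_lt t (by omega)).trans (by omega)
  set A : ℕ → Plane := fun i => P.corner ⟨i % (k + 1), Nat.mod_lt _ (by omega)⟩ with hA
  set s : ℕ → ℝ := fun t => P.param ⟨t / r % (k + 1), Nat.mod_lt _ (by omega)⟩ ⟨t % r, hmod t⟩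
    with hs
  have hrot : ∀ i : Fin (k + 1), P.corner (finRotate (k + 1) i) = A (i.val + 1) := by
    intro i
    rw [hA]
    congr 1
    ext
    simp [Fin.val_add]
  have hcor : ∀ i : Fin (k + 1), P.corner i = A i := by
    intro i
    rw [hA]
    congr 1
    ext
    simp [Nat.mod_eq_of_lt i.2]
  refine ⟨A, s, fun t => AffineMap.lineMap (A (t / r)) (A (t / r + 1)) (s t), ?_, ?_⟩
  · constructor
    · intro a b c hab hbc hc
      refine P.convex _ _ _ ?_ ?_ <;> rw [Fin.mk_lt_mk] <;>
        rwa [Nat.mod_eq_of_lt (by omega), Nat.mod_eq_of_lt (by omega)]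
    · simp [hA]
    · intro t ht
      simp only [hs]
      rw [← P.param_zero ⟨t / r % (k + 1), Nat.mod_lt _ (by omega)⟩]
      exact (P.param_strictMono _).monotone (Fin.zero_le _)
    · intro t ht
      simp only [hs]
      rw [← P.param_last ⟨t / r % (k + 1), Nat.mod_lt _ (by omega)⟩]
      refine P.param_strictMono _ ?_
      rw [Fin.lt_def]
      exact Nat.mod_lt t (by omega)
    · intro t ht hd
      simp only [hs]
      rw [← P.param_zero ⟨t / r % (k + 1), Nat.mod_lt _ (by omega)⟩]
      refine P.param_strictMono _ ?_
      rw [Fin.lt_def]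
      exact Nat.pos_of_ne_zero fun h => hd (Nat.dvd_of_mod_eq_zero h)
    · intro t ht hd
      simp only [hs]
      rw [← P.param_zero ⟨t / r % (k + 1), Nat.mod_lt _ (by omega)⟩]
      congr 1
      ext
      exact Nat.mod_eq_zero_of_dvd hd
    · intro t t' h1 h2 h3
      simp only [hs]
      have : (⟨t' / r % (k + 1), Nat.mod_lt _ (by omega)⟩ : Fin (k + 1)) =
          ⟨t / r % (k + 1), Nat.mod_lt _ (by omega)⟩ := by
        ext; simp only [h3]
      rw [this]
      refine P.param_strictMono _ ?_
      rw [Fin.lt_def]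
      have e1 := Nat.div_add_mod t r
      have e2 := Nat.div_add_mod t' r
      rw [← h3] at e2
      simp only
      omega
    · exact fun t _ => rfl
  · ext x
    constructor
    · rintro ⟨⟨i, j⟩, rfl⟩
      simp only [hrot, hcor]
      have hi : (i.val + 1) * r ≤ (k + 1) * r := Nat.mul_le_mul_right _ (by omega)
      have hir : (i.val + 1) * r = i.val * r + r := by ring
      rcases (show j.val < r ∨ j.val = r by omega) with hj | hj
      · have d1 : (i.val * r + j.val) / r = i.val := by
          rw [mul_comm, Nat.mul_add_div (by omega), Nat.div_eq_of_lt hj, add_zero]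
        have d2 : (i.val * r + j.val) % r = j.val := by
          rw [mul_comm, Nat.mul_add_mod, Nat.mod_eq_of_lt hj]
        refine ⟨i.val * r + j.val, by simp only [Set.mem_Iio]; omega, ?_⟩
        simp only [hs, d1, d2, Nat.mod_eq_of_lt i.2]
      · have hjl : j = Fin.last r := by ext; simpa using hj
        rw [hjl, P.param_last, AffineMap.lineMap_apply_one]
        refine ⟨(i.val + 1) % (k + 1) * r, ?_, ?_⟩
        · exact Nat.mul_lt_mul_of_pos_right (Nat.mod_lt _ (by omega)) (by omega)
        · have hz : s ((i.val + 1) % (k + 1) * r) = 0 := by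
            simp only [hs]
            rw [← P.param_zero ⟨(i.val + 1) % (k + 1) * r / r % (k + 1), Nat.mod_lt _ (by omega)⟩]
            congr 1
            ext
            simp
          simp only [hz, AffineMap.lineMap_apply_zero, Nat.mul_div_cancel _ (show 0 < r by omega)]
          simp only [hA, Nat.mod_mod]
    · rintro ⟨t, ht, rfl⟩
      refine ⟨(⟨t / r % (k + 1), Nat.mod_lt _ (by omega)⟩, ⟨t % r, hmod t⟩), ?_⟩
      simp only [hrot, hcor, hdiv t ht, hs]

lemma SubdividedPolygon.numTriangulations_eq {k r : ℕ} (hk : 3 ≤ k) (hr : 1 ≤ r)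
    (P : SubdividedPolygon k r) :
    numTriangulations P.points = triCount (ringLegal k r) 0 (k * r - 1) := by
  obtain ⟨A, s, q, R, h⟩ := P.exists_stringRing hk hr
  rw [h, R.numTriangulations_eq hk hr]

/-! ### Strictly convex polygons -/

lemma isForbiddenDiagonal_iff {k r a b : ℕ} (hr : 1 ≤ r) (hab : a < b) (hb : b < k * r) :
    IsForbiddenDiagonal k r a b ↔ ¬ ringLegal k r a b := by
  have hk : 1 ≤ k := by
    by_contra h
    obtain rfl : k = 0 := by omega
    simp at hb
  have hn := StringRing.mul_eq_add (k := k) (r := r) hk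
  have hside : (a ≠ b ∧ (a + 1) % (k * r) ≠ b ∧ (b + 1) % (k * r) ≠ a) ↔
      (b ≠ a + 1 ∧ ¬ (a = 0 ∧ b + 1 = k * r)) := by
    rw [Nat.mod_eq_of_lt (show a + 1 < k * r by omega)]
    rcases (show b + 1 < k * r ∨ b + 1 = k * r by omega) with h | h
    · rw [Nat.mod_eq_of_lt h]; omega
    · rw [h, Nat.mod_self]; omega
  have hstring : (∃ i < k, ∃ j ≤ r, ∃ l ≤ r, a = (i * r + j) % (k * r) ∧
      b = (i * r + l) % (k * r)) ↔ (b ≤ (a / r + 1) * r ∨ (a = 0 ∧ (k - 1) * r ≤ b)) := by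
    constructor
    · rintro ⟨i, hi, j, hj, l, hl, ha, hb'⟩
      have h1 : (i + 1) * r ≤ k * r := Nat.mul_le_mul_right _ hi
      have h2 : (i + 1) * r = i * r + r := by ring
      -- Since `a < b`, the vertex `b` is not `0` and cannot arise by wrapping around; only `a` can
      -- be the end of the last string.
      have hl' : i * r + l < k * r := by
        by_contra hcon
        rw [show i * r + l = k * r by omega, Nat.mod_self] at hb'
        omega
      rw [Nat.mod_eq_of_lt hl'] at hb'
      rcases (show i * r + j < k * r ∨ i * r + j = k * r by omega) with h | h
      · rw [Nat.mod_eq_of_lt h] at ha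
        left
        have h3 : i ≤ a / r := (Nat.le_div_iff_mul_le (by omega)).mpr (by omega)
        have h4 : (i + 1) * r ≤ (a / r + 1) * r := Nat.mul_le_mul_right _ (by omega)
        omega
      · rw [h, Nat.mod_self] at ha
        right
        exact ⟨ha, by omega⟩
    · rintro (h | ⟨rfl, h⟩)
      · have h1 : a / r < k := Nat.div_lt_of_lt_mul (by rw [mul_comm]; omega)
        have h2 := Nat.div_mul_le_self a r
        have h3 := le_next_corner hr a
        have h4 : (a / r + 1) * r = a / r * r + r := by ring
        refine ⟨a / r, h1, a - a / r * r, by omega, b - a / r * r, by omega, ?_, ?_⟩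
        · rw [Nat.mod_eq_of_lt (by omega)]; omega
        · rw [Nat.mod_eq_of_lt (by omega)]; omega
      · refine ⟨k - 1, by omega, r, le_rfl, b - (k - 1) * r, by omega, ?_, ?_⟩
        · rw [← hn, Nat.mod_self]
        · rw [Nat.mod_eq_of_lt (by omega)]; omega
  rw [IsForbiddenDiagonal, hside, hstring, ringLegal]
  constructor
  · rintro ⟨h1, h2, h3⟩ (h | h | h)
    · exact h2 h
    · exact h3 h
    · rcases h1 with h1 | ⟨h0, h1⟩
      · omega
      · have := h.2 h0
        omega
  · intro h
    push Not at h
    obtain ⟨h1, h2, h3⟩ := h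
    refine ⟨?_, h1, fun h => h2 h.1 h.2⟩
    rcases le_or_gt b ((a / r + 1) * r) with h | h
    · exact Or.inl h
    · exact Or.inr (h3 h)

lemma IsForbiddenDiagonal.symm {k r a b : ℕ} (h : IsForbiddenDiagonal k r a b) :
    IsForbiddenDiagonal k r b a := by
  obtain ⟨⟨i, hi, j, hj, l, hl, ha, hb⟩, h1, h2, h3⟩ := h
  exact ⟨⟨i, hi, l, hl, j, hj, hb, ha⟩, h1.symm, h3, h2⟩

/-- All orientations are positive, so the conditions of a chord system hold for any legality
relation containing the sides. Here legality is imposed by the definition of the count. -/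
lemma numLegalTriangulations_eq {k r : ℕ} (hr : 1 ≤ r) (h3 : 3 ≤ k * r)
    {Q : Fin (k * r) → Plane} (hQ : IsConvexPolygon Q) :
    numLegalTriangulations k r Q = triCount (ringLegal k r) 0 (k * r - 1) := by
  set q : ℕ → Plane := fun t => if h : t < k * r then Q ⟨t, h⟩ else 0 with hq
  have hqQ : ∀ a : Fin (k * r), q a = Q a := fun a => by simp [hq]
  have hpos : ∀ a b c, a < b → b < c → c < k * r → 0 < orient (q a) (q b) (q c) := by
    intro a b c hab hbc hc
    have := hQ ⟨a, by omega⟩ ⟨b, by omega⟩ ⟨c, hc⟩ hab hbc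
    rwa [← hqQ, ← hqQ, ← hqQ] at this
  have S : ChordSystem (k * r) q (ringLegal k r) := by
    constructor
    · exact fun a _ => Or.inl rfl
    · exact fun a b c h1 h2 h3 => (hpos a b c h1 h2 h3).le
    · exact fun a b c h1 h2 h3 _ => hpos a b c (by omega) h2 h3
    · exact fun a b c h1 h2 h3 _ => hpos a b c h1 (by omega) h3
    · exact fun a b c h1 h2 h3 _ _ => hpos a b c h1 h2 h3
    · exact fun b h1 h2 _ => hpos 0 b _ h1 (by omega) (by omega)
    · exact fun a b c h1 h2 h3 _ _ _ => hpos a b c h1 h2 h3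
  have hne : ∀ a b, a < b → b < k * r → q a ≠ q b := by
    intro a b hab hb h
    rcases (show 0 < a ∨ a + 1 < b ∨ (a = 0 ∧ b = 1) by omega) with h' | h' | ⟨rfl, rfl⟩
    · have := hpos 0 a b h' hab hb
      rw [h, orient_self_right] at this
      exact lt_irrefl _ this
    · have := hpos a (a + 1) b (by omega) h' hb
      rw [h, orient_self_left] at this
      exact lt_irrefl _ this
    · have := hpos 0 1 2 (by omega) (by omega) (by omega)
      rw [h, orient_same] at this
      exact lt_irrefl _ this
  have hinj : Set.InjOn q (Set.Iio (k * r)) := by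
    intro a ha b hb h
    rcases lt_trichotomy a b with h' | h' | h'
    · exact absurd h (hne a b h' hb)
    · exact h'
    · exact absurd h.symm (hne b a h' ha)
  have hrange : Set.range Q = q '' Set.Iio (k * r) := by
    ext x
    constructor
    · rintro ⟨a, rfl⟩
      exact ⟨a, a.2, hqQ a⟩
    · rintro ⟨t, ht, rfl⟩
      exact ⟨⟨t, ht⟩, (hqQ ⟨t, ht⟩).symm⟩
  rw [triCount, ← S.ncard_isTriangulation h3 (ringLegal_root (by omega)) hinj,
    numLegalTriangulations, hrange]
  congr 1
  ext T
  simp only [Set.mem_ofPred_eq]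
  refine and_congr_right fun hT => forall₂_congr fun τ hτ => ?_
  constructor
  · intro h
    obtain ⟨⟨a, b, c⟩, hab, hbc, hc, rfl⟩ := exists_vertexSet_eq (hT.card_eq τ hτ)
      (hT.inter_eq τ hτ ▸ Set.inter_subset_right)
    simp only at hab hbc hc
    have key : ∀ d e, d < e → e < k * r → q d ∈ vertexSet q (a, b, c) →
        q e ∈ vertexSet q (a, b, c) → ringLegal k r d e := by
      intro d e hde he hd' he'
      by_contra hL
      exact h ⟨d, by omega⟩ ⟨e, he⟩ ((isForbiddenDiagonal_iff hr hde he).mpr hL)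
        ⟨by rwa [← hqQ], by rwa [← hqQ]⟩
    refine ⟨(a, b, c), ⟨Nat.zero_le _, hab, hbc, by simp only; omega, ?_, ?_, ?_⟩, rfl⟩
    · exact key a b hab (by omega) (by simp [vertexSet]) (by simp [vertexSet])
    · exact key b c hbc hc (by simp [vertexSet]) (by simp [vertexSet])
    · exact key a c (by omega) hc (by simp [vertexSet]) (by simp [vertexSet])
  · rintro ⟨⟨a, b, c⟩, ⟨-, hab, hbc, hc, hLab, hLbc, hLac⟩, rfl⟩
    simp only at hab hbc hc hLab hLbc hLac
    have hmem : ∀ d : Fin (k * r), Q d ∈ vertexSet q (a, b, c) →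
        d.val = a ∨ d.val = b ∨ d.val = c := by
      intro d hd
      rw [← hqQ] at hd
      simp only [vertexSet, Finset.mem_insert, Finset.mem_singleton] at hd
      rcases hd with hd | hd | hd
      · exact Or.inl (hinj d.2 (by simp only [Set.mem_Iio]; omega) hd)
      · exact Or.inr (Or.inl (hinj d.2 (by simp only [Set.mem_Iio]; omega) hd))
      · exact Or.inr (Or.inr (hinj d.2 (by simp only [Set.mem_Iio]; omega) hd))
    have key : ∀ d e : Fin (k * r), d < e → Q d ∈ vertexSet q (a, b, c) →
        Q e ∈ vertexSet q (a, b, c) → ringLegal k r d e := by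
      intro d e hde hd he
      rw [Fin.lt_def] at hde
      rcases hmem d hd with h1 | h1 | h1 <;> rcases hmem e he with h2 | h2 | h2 <;>
        rw [h1, h2] at hde ⊢ <;> first | assumption | omega
    rintro d e hf ⟨hd, he⟩
    rcases lt_trichotomy d e with h | h | h
    · exact (isForbiddenDiagonal_iff hr h e.2).mp hf (key d e h hd he)
    · exact hf.2.1 (congrArg Fin.val h)
    · exact (isForbiddenDiagonal_iff hr h d.2).mp hf.symm (key e d h he hd)

end

/-! ### The three cases of the formula -/

theorem proposition6p1 (k r : ℕ) (hk : 1 ≤ k) (hr : 1 ≤ r) (hrk : 3 ≤ r * k) :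
    MeasureTheory.Integrable (saddleIntegrand k r) ∧
    (3 ≤ k → ∀ P : SubdividedPolygon k r,
      (numTriangulations P.points : ℂ) =
        -((2 : ℂ) ^ (((r : ℤ) - 2) * (k : ℤ)) / (Real.pi : ℂ)) * ∫ u : ℝ, saddleIntegrand k r u) ∧
    (k = 2 → ∀ Q : Fin (k * r) → Plane, IsConvexPolygon Q →
      (numLegalTriangulations k r Q : ℂ) =
        -((2 : ℂ) ^ (((r : ℤ) - 2) * (k : ℤ)) / (Real.pi : ℂ)) * ∫ u : ℝ, saddleIntegrand k r u) ∧
    (k = 1 →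
      (∑ m ∈ Finset.range (r / 2 + 1),
          (-1 : ℂ) ^ m * ((r - m).choose m : ℂ) * (catalan (r - m - 2) : ℂ)) =
        -((2 : ℂ) ^ (((r : ℤ) - 2) * (k : ℤ)) / (Real.pi : ℂ)) * ∫ u : ℝ, saddleIntegrand k r u) := by
  rcases (show k = 1 ∨ 2 ≤ k by omega) with rfl | hk2
  · obtain ⟨M, e, he, hval⟩ := single_string_expansion (r := r) (by omega)
    obtain ⟨hint, hI⟩ := integral_saddle he
    refine ⟨hint, by omega, by omega, fun _ => ?_⟩
    rw [← hI, ← hval]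
    push_cast
    rfl
  · have h3 : 3 ≤ k * r := by rwa [mul_comm]
    obtain ⟨M, e, he, hval⟩ := exists_catalan_expansion hk2 hr h3
    obtain ⟨hint, hI⟩ := integral_saddle (k := k) (r := r) fun x _ => he x
    refine ⟨hint, fun hk3 P => ?_, fun _ Q hQ => ?_, by omega⟩
    · rw [← hI, ← hval, P.numTriangulations_eq hk3 hr, Complex.ofReal_natCast]
    · rw [← hI, ← hval, numLegalTriangulations_eq hr h3 hQ, Complex.ofReal_natCast]
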